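/- **Setting.** A stochastic game consists of a finite set of states $S=S_\Diamond\uplus S_\Box$ (controller and environment states), an initial state $\bar s$, a finite set of actions, a non-empty set $A(s)$ of enabled actions for each $s\in S$, and a distribution $\delta(s,a)$ on $S$ for each $s\in S$, $a\in A(s)$. Strategies are memoryless and may be randomised: $\sigma$ (controller) and $\pi$ (environment) assign to each state of their player a distribution on $A(s)$; $E_s^{\sigma,\pi}(\rho)$ is the expected total reward $\sum_j\rho(s_j,a_j)$ over infinite paths from $s$. A multi-strategy $\theta$ assigns to each $s\in S_\Diamond$ a distribution on the non-empty subsets of $A(s)$; it is deterministic if all these distributions are Dirac, and then $\theta(s)$ also denotes the chosen set. A controller strategy $\sigma$ complies with $\theta$ if for all $s\in S_\Diamond$ there are distributions $d_{s,B}$ on $B$ (for $\emptyset\ne B\subseteq A(s)$) with $\sigma(s)(a)=\sum_{B\ni a}\theta(s)(B)\,d_{s,B}(a)$ for all $a\in A(s)$. Let $r\ge 0$ be a reward structure, scaled so that $\sup_{\sigma,\pi}E_s^{\sigma,\pi}(r)<1$ for all $s$, and let $b\in\mathbb R$. A multi-strategy $\theta$ is sound if $E_{\bar s}^{\sigma,\pi}(r)\ge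 b$ for all $\sigma$ complying with $\theta$ and all $\pi$. Let $\psi(s,a)\ge 0$ ($s\in S_\Diamond$, $a\in A(s)$) be penalties. The dynamic penalty of $\theta$ from $s$ is $\mathrm{pen}(\theta,s)=\sup E_s^{\sigma,\pi}(\rho_\theta)\in[0,\infty]$ over all $\sigma$ complying with $\theta$ and all $\pi$, where $\rho_\theta(s,a)=\sum_{B\subseteq A(s)}\sum_{a'\in A(s)\setminus B}\theta(s)(B)\,\psi(s,a')$ for $s\in S_\Diamond$ and $\rho_\theta(s,a)=0$ for $s\in S_\Box$. The penalty of $\theta$ is $\mathrm{pen}(\theta,\bar s)$; a sound deterministic $\theta$ is optimally permissive if its penalty is the infimum of the penalties of all sound deterministic multi-strategies. Let $c\ge 0$ be a constant that is no lower than any finite value $\mathrm{pen}(\theta,s)$ with $\theta$ deterministic and $s\in S$. **The MILP.** Variables: $y_{s,a},\alpha_s,\beta_{s,a,t}\in\{0,1\}$, $x_s,\gamma_s\in[0,1]$, $z_s\ge 0$ for $s,t\in S$, and $\ell_s\in\mathbb R$ for $s\in S_\Diamond$. Minimise $z_{\bar s}$ subject to (with $a$ ranging over $A(s)$): 1. $x_{\bar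 s}\ge b$; 2. $1\le\sum_{a\in A(s)}y_{s,a}$ for $s\in S_\Diamond$; 3. $x_s\le\sum_t\delta(s,a)(t)x_t+r(s,a)+(1-y_{s,a})$ for $s\in S_\Diamond$; 4. $x_s\le\sum_t\delta(s,a)(t)x_t+r(s,a)$ for $s\in S_\Box$; 5. $x_s\le\alpha_s$ for $s\in S$; 6. $y_{s,a}\le(1-\alpha_s)+\sum_{t\in\mathrm{supp}\,\delta(s,a)}\beta_{s,a,t}$ for $s\in S$; 7. $y_{s,a}=1$ for $s\in S_\Box$; 8. $\gamma_t<\gamma_s+(1-\beta_{s,a,t})+r(s,a)$ for $s\in S$, $t\in\mathrm{supp}\,\delta(s,a)$; 9. $\ell_s=\sum_{a\in A(s)}\psi(s,a)(1-y_{s,a})$ for $s\in S_\Diamond$; 10. $z_s\ge\sum_t\delta(s,a)(t)z_t+\ell_s-c(1-y_{s,a})$ for $s\in S_\Diamond$; 11. $z_s\ge\sum_t\delta(s,a)(t)z_t$ for $s\in S_\Box$. **Theorem.** Assume that some sound (possibly randomised) multi-strategy exists. Then an optimally permissive deterministic multi-strategy exists, and: (a) the MILP has no feasible assignment if and only if an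 optimally permissive deterministic multi-strategy has infinite penalty; (b) for every real $p$: the minimum of $z_{\bar s}$ over the feasible assignments exists and equals $p$ if and only if an optimally permissive deterministic multi-strategy has penalty $p$. Moreover, if $\psi(s,a)>0$ for all $s\in S_\Diamond$ with at least two enabled actions and all $a\in A(s)$, then (a) and (b) also hold for the MILP with equality instead of $\le$ in constraint 6. -/

import Mathlib

open scoped NNReal ENNReal

namespace PermissiveSynthesis

/-- A turn-based stochastic two-player game with state space `S` and action set `A`. The states in
`controller` belong to player `◇`, the remaining ones to player `□`. The partial transition function
is given by its domain (`a ∈ enabled s`) and its values `δ s a`; the values of `δ` outside its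
domain play no role. Every state has an enabled action, so that plays never get stuck. -/
structure StochasticGame (S A : Type*) where
  controller : Set S
  init : S
  enabled : S → Finset A
  enabled_nonempty : ∀ s, (enabled s).Nonempty
  δ : S → A → PMF S

variable {S A : Type*}

/-- One step of a path `s₀ a₀ s₁ a₁ …`: the current state and the action taken there. -/
structure Step (S A : Type*) where
  state : S
  action : A

instance : MeasurableSpace (Step S A) := ⊤

namespace StochasticGame

/-- Memoryless (randomised) strategies of the player owning the states in `P`; only enabled actions
may be chosen with positive probability. -/
structure Strategy (G : StochasticGame S A) (P : Set S) where
  choice : P → PMF A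
  support_subset : ∀ s, ∀ a ∈ (choice s).support, a ∈ G.enabled s

variable (G : StochasticGame S A)

/-- The action distribution in each state when the players use `σ` and `π`. -/
noncomputable def actionDist (σ : G.Strategy G.controller) (π : G.Strategy G.controllerᶜ)
    (s : S) : PMF A :=
  open Classical in
  if h : s ∈ G.controller then σ.choice ⟨s, h⟩ else π.choice ⟨s, h⟩

/-- The distribution of the step taken in state `s`. -/
noncomputable def stepDist (σ : G.Strategy G.controller) (π : G.Strategy G.controllerᶜ)
    (s : S) : PMF (Step S A) :=
  (G.actionDist σ π s).map fun a => ⟨s, a⟩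

/-- The Markov kernel from one step of a path to the next one: draw the successor state from
`δ(s, a)` and then an action in it. -/
noncomputable def stepKernel (σ : G.Strategy G.controller) (π : G.Strategy G.controllerᶜ) :
    ProbabilityTheory.Kernel (Step S A) (Step S A) where
  toFun p := ((G.δ p.state p.action).bind (G.stepDist σ π)).toMeasure
  measurable' := measurable_from_top

instance (σ : G.Strategy G.controller) (π : G.Strategy G.controllerᶜ) :
    ProbabilityTheory.IsMarkovKernel (G.stepKernel σ π) where
  isProbabilityMeasure p :=
    inferInstanceAs (MeasureTheory.IsProbabilityMeasure
      ((G.δ p.state p.action).bind (G.stepDist σ π)).toMeasure)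

/-- The probability measure `Pr_s^{σ,π}` on infinite paths from `s`. -/
noncomputable def pathMeasure (σ : G.Strategy G.controller) (π : G.Strategy G.controllerᶜ)
    (s : S) : MeasureTheory.Measure (ℕ → Step S A) :=
  ProbabilityTheory.Kernel.trajMeasure (X := fun _ => Step S A) (G.stepDist σ π s).toMeasure
    fun n => (G.stepKernel σ π).comap (fun h => h ⟨n, Finset.mem_Iic.2 le_rfl⟩)
      (measurable_pi_apply _)

/-- The expected total reward `E_s^{σ,π}(ρ)`. -/
noncomputable def expectedReward (ρ : S → A → ℝ≥0) (σ : G.Strategy G.controller)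
    (π : G.Strategy G.controllerᶜ) (s : S) : ℝ≥0∞ :=
  ∫⁻ ω, ∑' j, (ρ (ω j).state (ω j).action : ℝ≥0∞) ∂(G.pathMeasure σ π s)

/-- The maximal expected total reward `sup_{σ,π} E_s^{σ,π}(ρ)`. -/
noncomputable def maxReward (ρ : S → A → ℝ≥0) (s : S) : ℝ≥0∞ :=
  ⨆ (σ : G.Strategy G.controller) (π : G.Strategy G.controllerᶜ), G.expectedReward ρ σ π s

/-- A controller strategy is sound for the property `R_{≥ b}[C]`: whatever the environment does, the
expected total reward from the initial state is at least `b`. (Rewards are non-negative, so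
replacing `b` by `max b 0` changes nothing.) -/
def SoundStrategy (r : S → A → ℝ≥0) (b : ℝ) (σ : G.Strategy G.controller) : Prop :=
  ∀ π : G.Strategy G.controllerᶜ, ENNReal.ofReal b ≤ G.expectedReward r σ π G.init

/-- Memoryless (randomised) multi-strategies: in each controller state, a distribution on the
non-empty sets of enabled actions. -/
structure MultiStrategy where
  choice : G.controller → PMF (Finset A)
  support_subset : ∀ s, ∀ B ∈ (choice s).support, B.Nonempty ∧ B ⊆ G.enabled s

variable {G}

/-- A multi-strategy is deterministic if all its distributions are Dirac. -/
def MultiStrategy.IsDeterministic (θ : G.MultiStrategy) : Prop :=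
  ∀ s, ∃ B, θ.choice s = PMF.pure B

open Classical in
/-- `σ` complies with `θ`. -/
def Complies (σ : G.Strategy G.controller) (θ : G.MultiStrategy) : Prop :=
  ∀ s : G.controller, ∃ d : Finset A → PMF A,
    (∀ B, B.Nonempty → B ⊆ G.enabled s → ∀ a ∈ (d B).support, a ∈ B) ∧
    ∀ a ∈ G.enabled s,
      σ.choice s a = ∑ B ∈ (G.enabled s).powerset with a ∈ B, θ.choice s B * d B a

/-- A multi-strategy is sound if all strategies complying with it are. -/
def MultiStrategy.Sound (θ : G.MultiStrategy) (r : S → A → ℝ≥0) (b : ℝ) : Prop :=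
  ∀ σ : G.Strategy G.controller, Complies σ θ → G.SoundStrategy r b σ

open Classical in
/-- The local penalty of `θ` in the controller state `s`. -/
noncomputable def MultiStrategy.localPenalty (θ : G.MultiStrategy) (ψ : G.controller → A → ℝ≥0)
    (s : G.controller) : ℝ≥0 :=
  ∑ B ∈ (G.enabled s).powerset, ∑ a ∈ G.enabled s \ B, (θ.choice s B).toNNReal * ψ s a

open Classical in
/-- The reward structure given by the local penalties. -/
noncomputable def MultiStrategy.penaltyReward (θ : G.MultiStrategy) (ψ : G.controller → A → ℝ≥0) :
    S → A → ℝ≥0 :=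
  fun s _ => if h : s ∈ G.controller then θ.localPenalty ψ ⟨s, h⟩ else 0

/-- The dynamic penalty of `θ` from state `s`. -/
noncomputable def MultiStrategy.dynPenalty (θ : G.MultiStrategy) (ψ : G.controller → A → ℝ≥0)
    (s : S) : ℝ≥0∞ :=
  ⨆ (σ : G.Strategy G.controller) (π : G.Strategy G.controllerᶜ) (_ : Complies σ θ),
    G.expectedReward (θ.penaltyReward ψ) σ π s

/-- `θ` is an optimally permissive deterministic multi-strategy for `R_{≥ b}[C]` and the dynamic
penalty scheme given by `ψ`. -/
def MultiStrategy.OptimallyPermissive (θ : G.MultiStrategy) (r : S → A → ℝ≥0) (b : ℝ)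
    (ψ : G.controller → A → ℝ≥0) : Prop :=
  θ.IsDeterministic ∧ θ.Sound r b ∧
    θ.dynPenalty ψ G.init =
      ⨅ (θ' : G.MultiStrategy) (_ : θ'.IsDeterministic) (_ : θ'.Sound r b), θ'.dynPenalty ψ G.init

variable (G)

/-- Values of the variables of the MILP. -/
structure Assignment where
  y : S → A → ℝ
  x : S → ℝ
  α : S → ℝ
  β : S → A → S → ℝ
  γ : S → ℝ
  ℓ : G.controller → ℝ
  z : S → ℝ

variable {G}

open Classical in
/-- The assignment `v` satisfies the constraints of the MILP for deterministic multi-strategies with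
dynamic penalties, where the relation `R` is used in the constraint that relates `y s a` to
`(1 - α s) + ∑ t, β s a t`. -/
structure Assignment.Feasible [Fintype S] (v : G.Assignment) (r : S → A → ℝ≥0) (b : ℝ)
    (ψ : G.controller → A → ℝ≥0) (c : ℝ≥0) (R : ℝ → ℝ → Prop) : Prop where
  y_mem : ∀ s a, v.y s a = 0 ∨ v.y s a = 1
  x_mem : ∀ s, 0 ≤ v.x s ∧ v.x s ≤ 1
  α_mem : ∀ s, v.α s = 0 ∨ v.α s = 1
  β_mem : ∀ s a t, v.β s a t = 0 ∨ v.β s a t = 1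
  γ_mem : ∀ s, 0 ≤ v.γ s ∧ v.γ s ≤ 1
  z_nonneg : ∀ s, 0 ≤ v.z s
  reward_init : b ≤ v.x G.init
  some_allowed : ∀ s ∈ G.controller, 1 ≤ ∑ a ∈ G.enabled s, v.y s a
  reward_controller : ∀ s ∈ G.controller, ∀ a ∈ G.enabled s,
    v.x s ≤ ∑ t, (G.δ s a t).toReal * v.x t + r s a + (1 - v.y s a)
  reward_environment : ∀ s ∉ G.controller, ∀ a ∈ G.enabled s,
    v.x s ≤ ∑ t, (G.δ s a t).toReal * v.x t + r s a
  x_le_α : ∀ s, v.x s ≤ v.α s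
  y_β : ∀ s, ∀ a ∈ G.enabled s,
    R (v.y s a) ((1 - v.α s) + ∑ t with t ∈ (G.δ s a).support, v.β s a t)
  y_environment : ∀ s ∉ G.controller, ∀ a ∈ G.enabled s, v.y s a = 1
  ranking : ∀ s, ∀ a ∈ G.enabled s, ∀ t ∈ (G.δ s a).support,
    v.γ t < v.γ s + (1 - v.β s a t) + r s a
  local_penalty : ∀ s : G.controller,
    v.ℓ s = ∑ a ∈ G.enabled s, (ψ s a : ℝ) * (1 - v.y s a)
  penalty_controller : ∀ s : G.controller, ∀ a ∈ G.enabled s,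
    ∑ t, (G.δ s a t).toReal * v.z t + v.ℓ s - c * (1 - v.y s a) ≤ v.z s
  penalty_environment : ∀ s ∉ G.controller, ∀ a ∈ G.enabled s,
    ∑ t, (G.δ s a t).toReal * v.z t ≤ v.z s

variable (G)

/-- `p` is the optimal value of the MILP, i.e. the (attained) minimum of `z` in the initial state
over all feasible assignments. -/
def IsOptimalValue [Fintype S] (r : S → A → ℝ≥0) (b : ℝ) (ψ : G.controller → A → ℝ≥0) (c : ℝ≥0)
    (R : ℝ → ℝ → Prop) (p : ℝ) : Prop :=
  IsLeast {q | ∃ v : G.Assignment, v.Feasible r b ψ c R ∧ q = v.z G.init} p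

/-- (a) The MILP has no solution iff an optimally permissive deterministic multi-strategy has
infinite penalty; (b) `p` is its optimal value iff an optimally permissive deterministic
multi-strategy has penalty `p`. -/
def EncodingCorrect [Fintype S] (r : S → A → ℝ≥0) (b : ℝ) (ψ : G.controller → A → ℝ≥0) (c : ℝ≥0)
    (R : ℝ → ℝ → Prop) : Prop :=
  ((¬ ∃ v : G.Assignment, v.Feasible r b ψ c R) ↔
    ∃ θ : G.MultiStrategy, θ.OptimallyPermissive r b ψ ∧ θ.dynPenalty ψ G.init = ⊤) ∧
  ∀ p : ℝ, G.IsOptimalValue r b ψ c R p ↔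
    ∃ θ : G.MultiStrategy, θ.OptimallyPermissive r b ψ ∧
      θ.dynPenalty ψ G.init ≠ ⊤ ∧ (θ.dynPenalty ψ G.init).toReal = p

end StochasticGame

end PermissiveSynthesis

/-!
A deterministic multi-strategy amounts to a selection `B` of allowed actions (`detMulti`), and an
assignment of the binary variables `y` encodes such a selection. All expected total rewards are
treated as least fixed points of monotone operators on `S → ℝ≥0∞`: the expected reward of a pair of
memoryless strategies is the least solution of its Bellman equations
(`expectedReward_eq_policyValue`), and the optimal rewards of games are least fixed points of the
Bellman operators with maxima and minima. Pure memoryless strategies attain these values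
(`exists_minimiser`, `exists_maximiser`); for the maximiser this is shown by discounting, as one of
the finitely many strategies is optimal for discount factors arbitrarily close to `1`. Consequently
soundness of `detMulti` bounds the least fixed point of a minimising operator from below, its
penalty is the least fixed point of a maximising one, and a sound randomised multi-strategy can be
replaced by a deterministic one (`exists_sound_detMulti`). There are finitely many deterministic
multi-strategies, so one of the sound ones is optimal.

A feasible assignment gives a sound multi-strategy (`Assignment.Feasible.exists_sound`): `z` is a
super-solution of the Bellman equations for the penalty and hence bounds it from above. The values
`x` are a sub-solution of the Bellman equations for the reward, which in general need not lie below
the least solution, but the variables `γ` exclude closed sets of states with positive `x` in which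
no reward is collected (`le_policyValue_of_ranking`).

Conversely, let a sound deterministic multi-strategy have finite penalty
(`exists_feasible_of_sound`). States with infinite penalty are unreachable, so all their actions may
be allowed, and `z = c` is a valid choice there; elsewhere `z` is the penalty. For `x` take the
minimal rewards. The ranking `γ` exists (`exists_ranking`) because a set of states in which one can
stay forever without reward has minimal reward `0`. With equality in the constraint on `y`, `α` and
`β`, the ranking is also needed in states with `x = 0` in which some action is disallowed; there it
exists because staying forever in such states would accumulate an infinite penalty.
-/

/-! ### Expected rewards as least fixed points -/

namespace PermissiveSynthesis

open MeasureTheory ProbabilityTheory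

section Values

variable {S A : Type*} [Fintype S]

/-- The value of playing `a` in `s` when the continuation is worth `w` and is discounted by `l`. -/
noncomputable def backup (δ : S → A → PMF S) (ρ : S → A → ℝ≥0) (l : ℝ≥0∞) (w : S → ℝ≥0∞)
    (s : S) (a : A) : ℝ≥0∞ :=
  ρ s a + l * ∑ t, δ s a t * w t

lemma backup_mono (δ : S → A → PMF S) (ρ : S → A → ℝ≥0) {l l' : ℝ≥0∞} (hl : l ≤ l')
    {w w' : S → ℝ≥0∞} (h : w ≤ w') (s : S) (a : A) :
    backup δ ρ l w s a ≤ backup δ ρ l' w' s a := by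
  unfold backup
  gcongr with t
  exact h t

variable [Fintype A]

/-- The Bellman operator of a Markov chain: in `s` the action is drawn from `μ s`. -/
noncomputable def policyOp (δ : S → A → PMF S) (ρ : S → A → ℝ≥0) (l : ℝ≥0∞) (μ : S → PMF A) :
    (S → ℝ≥0∞) →o (S → ℝ≥0∞) where
  toFun w s := ∑ a, μ s a * backup δ ρ l w s a
  monotone' w w' h s := by
    dsimp only
    gcongr with a
    exact backup_mono δ ρ le_rfl h s a

/-- The expected (discounted) total reward of a Markov chain, as the least fixed point of its
Bellman operator. -/
noncomputable def policyValue (δ : S → A → PMF S) (ρ : S → A → ℝ≥0) (l : ℝ≥0∞)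
    (μ : S → PMF A) : S → ℝ≥0∞ :=
  (policyOp δ ρ l μ).lfp

lemma policyValue_eq (δ : S → A → PMF S) (ρ : S → A → ℝ≥0) (l : ℝ≥0∞) (μ : S → PMF A) (s : S) :
    policyValue δ ρ l μ s = ∑ a, μ s a * backup δ ρ l (policyValue δ ρ l μ) s a :=
  (congrFun (policyOp δ ρ l μ).map_lfp s).symm

lemma policyValue_le {δ : S → A → PMF S} {ρ : S → A → ℝ≥0} {l : ℝ≥0∞} {μ : S → PMF A}
    {w : S → ℝ≥0∞} (h : ∀ s, ∑ a, μ s a * backup δ ρ l w s a ≤ w s) :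
    policyValue δ ρ l μ ≤ w :=
  OrderHom.lfp_le _ h

lemma policyValue_mono_discount (δ : S → A → PMF S) (ρ : S → A → ℝ≥0) {l l' : ℝ≥0∞}
    (hl : l ≤ l') (μ : S → PMF A) : policyValue δ ρ l μ ≤ policyValue δ ρ l' μ := by
  refine policyValue_le fun s => ?_
  rw [policyValue_eq δ ρ l']
  gcongr with a
  exact backup_mono δ ρ hl le_rfl s a

end Values

section Integrals

variable {X Y : Type*} [MeasurableSpace Y] [Countable Y] [MeasurableSingletonClass Y]

lemma lintegral_pmf (p : PMF Y) (f : Y → ℝ≥0∞) :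
    ∫⁻ y, f y ∂p.toMeasure = ∑' y, p y * f y := by
  rw [lintegral_countable']
  refine tsum_congr fun y => ?_
  rw [p.toMeasure_apply_singleton y (measurableSet_singleton y), mul_comm]

lemma lintegral_pmf_bind (p : PMF X) (g : X → PMF Y) (f : Y → ℝ≥0∞) :
    ∫⁻ y, f y ∂(p.bind g).toMeasure = ∑' x, p x * ∫⁻ y, f y ∂(g x).toMeasure := by
  simp_rw [lintegral_pmf, PMF.bind_apply, ← ENNReal.tsum_mul_left, ← ENNReal.tsum_mul_right]
  rw [ENNReal.tsum_comm]
  simp_rw [mul_assoc]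

lemma lintegral_pmf_map (p : PMF X) (g : X → Y) (f : Y → ℝ≥0∞) :
    ∫⁻ y, f y ∂(p.map g).toMeasure = ∑' x, p x * f (g x) := by
  rw [← PMF.bind_pure_comp, lintegral_pmf_bind]
  refine tsum_congr fun x => ?_
  simp [PMF.toMeasure_pure]

end Integrals

namespace StochasticGame

variable {S A : Type*} (G : StochasticGame S A)

instance [Finite S] [Finite A] : Countable (Step S A) :=
  Function.Injective.countable (f := fun p : Step S A => (p.state, p.action))
    fun ⟨_, _⟩ ⟨_, _⟩ h => by simp_all

instance : MeasurableSingletonClass (Step S A) := ⟨fun _ => trivial⟩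

variable (σ : G.Strategy G.controller) (π : G.Strategy G.controllerᶜ)

lemma lintegral_pathMeasure_zero (f : Step S A → ℝ≥0∞) (s : S) :
    ∫⁻ ω, f (ω 0) ∂(G.pathMeasure σ π s) = ∫⁻ p, f p ∂(G.stepDist σ π s).toMeasure := by
  have hf : Measurable f := measurable_from_top
  rw [pathMeasure, Kernel.trajMeasure]
  have h0 : ∀ ω : ℕ → Step S A,
      f (ω 0) = (fun h : (i : Finset.Iic 0) → Step S A => f (h ⟨0, by simp⟩))
        (Preorder.frestrictLe (π := fun _ => Step S A) 0 ω) := fun ω => rfl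
  simp_rw [h0]
  rw [← lintegral_map (f := fun h : (i : Finset.Iic 0) → Step S A => f (h ⟨0, by simp⟩))
    (hf.comp (measurable_pi_apply _)) (by fun_prop), Measure.map_comp _ _ (by fun_prop),
    Kernel.traj_map_frestrictLe, Kernel.partialTraj_self, Measure.id_comp,
    lintegral_map (f := fun h : (i : Finset.Iic 0) → Step S A => f (h ⟨0, by simp⟩))
      (hf.comp (measurable_pi_apply _)) (by fun_prop)]
  rfl

lemma lintegral_pathMeasure_succ (f : Step S A → ℝ≥0∞) (s : S) (n : ℕ) :
    ∫⁻ ω, f (ω (n + 1)) ∂(G.pathMeasure σ π s) =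
      ∫⁻ ω, ∫⁻ q, f q ∂(G.stepKernel σ π (ω n)) ∂(G.pathMeasure σ π s) := by
  have hf : Measurable f := measurable_from_top
  have key := Kernel.map_frestrictLe_trajMeasure_compProd_eq_map_trajMeasure
    (X := fun _ => Step S A) (μ₀ := (G.stepDist σ π s).toMeasure)
    (κ := fun n => (G.stepKernel σ π).comap (fun h => h ⟨n, Finset.mem_Iic.2 le_rfl⟩)
      (measurable_pi_apply _)) (a := n)
  let g : ((i : Finset.Iic n) → Step S A) × Step S A → ℝ≥0∞ := fun p => f p.2
  have hg : Measurable g := hf.comp measurable_snd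
  have hf' : Measurable fun p => ∫⁻ q, f q ∂(G.stepKernel σ π p) := measurable_from_top
  have h := congrArg (fun m => ∫⁻ p, g p ∂m) key
  rw [lintegral_map hg (by fun_prop), Measure.lintegral_compProd hg] at h
  exact h.symm.trans (lintegral_map (f := fun h : (i : Finset.Iic n) → Step S A =>
    ∫⁻ q, f q ∂(G.stepKernel σ π (h ⟨n, Finset.mem_Iic.2 le_rfl⟩)))
    (hf'.comp (measurable_pi_apply _)) (by fun_prop))

variable [Fintype S] [Fintype A]

lemma lintegral_stepDist (f : Step S A → ℝ≥0∞) (s : S) :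
    ∫⁻ p, f p ∂(G.stepDist σ π s).toMeasure = ∑ a, G.actionDist σ π s a * f ⟨s, a⟩ := by
  rw [stepDist, lintegral_pmf_map, tsum_fintype]

lemma lintegral_stepKernel (f : Step S A → ℝ≥0∞) (p : Step S A) :
    ∫⁻ q, f q ∂(G.stepKernel σ π p) =
      ∑ t, G.δ p.state p.action t * ∫⁻ q, f q ∂(G.stepDist σ π t).toMeasure := by
  change ∫⁻ q, f q ∂((G.δ p.state p.action).bind (G.stepDist σ π)).toMeasure = _
  rw [lintegral_pmf_bind, tsum_fintype]

/-- The expected reward of step `n` when the play starts in `s`. -/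
noncomputable def stepReward (ρ : S → A → ℝ≥0) : ℕ → S → ℝ≥0∞
  | 0, s => ∑ a, G.actionDist σ π s a * ρ s a
  | n + 1, s => ∑ a, G.actionDist σ π s a * ∑ t, G.δ s a t * stepReward ρ n t

lemma lintegral_pathMeasure_reward (ρ : S → A → ℝ≥0) (n : ℕ) (s : S) :
    ∫⁻ ω, (ρ (ω n).state (ω n).action : ℝ≥0∞) ∂(G.pathMeasure σ π s) =
      G.stepReward σ π ρ n s := by
  -- `F k` is the `k`-fold image of the reward function under the transition kernel
  let K : (Step S A → ℝ≥0∞) → Step S A → ℝ≥0∞ := fun f p => ∫⁻ q, f q ∂(G.stepKernel σ π p)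
  let F : ℕ → Step S A → ℝ≥0∞ := fun k => K^[k] fun p => ρ p.state p.action
  have hF : ∀ k, F (k + 1) = K (F k) := fun k => Function.iterate_succ_apply' K k _
  have h1 : ∀ m k, ∫⁻ ω, F k (ω m) ∂(G.pathMeasure σ π s) =
      ∫⁻ p, F (k + m) p ∂(G.stepDist σ π s).toMeasure := by
    intro m
    induction m with
    | zero => exact fun k => G.lintegral_pathMeasure_zero σ π _ s
    | succ m ih =>
      intro k
      rw [lintegral_pathMeasure_succ, add_comm m, ← add_assoc, ← ih, hF]
  have h2 : ∀ k t, ∫⁻ p, F k p ∂(G.stepDist σ π t).toMeasure = G.stepReward σ π ρ k t := by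
    intro k
    induction k with
    | zero => exact fun t => G.lintegral_stepDist σ π _ t
    | succ k ih =>
      intro t
      rw [lintegral_stepDist, stepReward]
      simp_rw [hF, K, lintegral_stepKernel, ih]
  have := h1 n 0
  rw [zero_add, h2] at this
  exact this

lemma expectedReward_eq_tsum (ρ : S → A → ℝ≥0) (s : S) :
    G.expectedReward ρ σ π s = ∑' n, G.stepReward σ π ρ n s := by
  rw [expectedReward, lintegral_tsum]
  · exact tsum_congr fun n => G.lintegral_pathMeasure_reward σ π ρ n s
  · intro n
    have : Measurable fun p : Step S A => (ρ p.state p.action : ℝ≥0∞) := measurable_from_top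
    exact (this.comp (measurable_pi_apply n)).aemeasurable

/-- The expected total reward is the least solution of the Bellman equations. -/
theorem expectedReward_eq_policyValue (ρ : S → A → ℝ≥0) :
    G.expectedReward ρ σ π = policyValue G.δ ρ 1 (G.actionDist σ π) := by
  apply le_antisymm
  · intro s
    rw [expectedReward_eq_tsum, ENNReal.tsum_eq_iSup_nat]
    refine iSup_le fun n => ?_
    induction n generalizing s with
    | zero => simp
    | succ n ih =>
      rw [Finset.sum_range_succ', policyValue_eq]
      simp only [stepReward, backup, one_mul]
      rw [Finset.sum_comm, ← Finset.sum_add_distrib]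
      refine Finset.sum_le_sum fun a _ => ?_
      rw [← Finset.mul_sum, ← mul_add, Finset.sum_comm, add_comm]
      simp_rw [← Finset.mul_sum]
      gcongr with t
      exact ih t
  · refine policyValue_le fun s => le_of_eq ?_
    simp only [backup, one_mul, mul_add, Finset.sum_add_distrib, expectedReward_eq_tsum]
    rw [tsum_eq_zero_add' ENNReal.summable]
    simp only [stepReward]
    congr 1
    rw [Summable.tsum_finsetSum fun _ _ => ENNReal.summable]
    refine Finset.sum_congr rfl fun a _ => ?_
    rw [ENNReal.tsum_mul_left, Summable.tsum_finsetSum fun _ _ => ENNReal.summable]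
    simp_rw [ENNReal.tsum_mul_left]

end StochasticGame
end PermissiveSynthesis

/-! ### Values of games and optimal memoryless strategies -/

namespace PermissiveSynthesis

section PMFSums

variable {X : Type*} [Fintype X]

lemma sum_pmf_mul_const (p : PMF X) (c : ℝ≥0∞) : ∑ x, p x * c = c := by
  rw [← Finset.sum_mul, ← tsum_fintype (L := .unconditional X), p.tsum_coe, one_mul]

lemma sum_pmf_mul_congr (p : PMF X) {f g : X → ℝ≥0∞} (h : ∀ x ∈ p.support, f x = g x) :
    ∑ x, p x * f x = ∑ x, p x * g x := by
  refine Finset.sum_congr rfl fun x _ => ?_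
  by_cases hx : x ∈ p.support
  · rw [h x hx]
  · rw [(p.apply_eq_zero_iff x).2 hx, zero_mul, zero_mul]

lemma sum_pmf_mul_mono (p : PMF X) {f g : X → ℝ≥0∞} (h : ∀ x ∈ p.support, f x ≤ g x) :
    ∑ x, p x * f x ≤ ∑ x, p x * g x := by
  refine Finset.sum_le_sum fun x _ => ?_
  by_cases hx : x ∈ p.support
  · gcongr
    exact h x hx
  · rw [(p.apply_eq_zero_iff x).2 hx, zero_mul, zero_mul]

lemma sum_pmf_mul_le (p : PMF X) {f : X → ℝ≥0∞} {c : ℝ≥0∞} (h : ∀ x ∈ p.support, f x ≤ c) :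
    ∑ x, p x * f x ≤ c :=
  (sum_pmf_mul_mono p h).trans_eq (sum_pmf_mul_const p c)

lemma le_sum_pmf_mul (p : PMF X) {f : X → ℝ≥0∞} {c : ℝ≥0∞} (h : ∀ x ∈ p.support, c ≤ f x) :
    c ≤ ∑ x, p x * f x :=
  (sum_pmf_mul_const p c).symm.trans_le (sum_pmf_mul_mono p h)

end PMFSums

variable {S A : Type*} [Fintype S]

open Classical in
/-- The Bellman operator of a game in which the player owning `P` maximises and the opponent
minimises, both choosing from the sets `B s`. -/
noncomputable def gameOp (δ : S → A → PMF S) (ρ : S → A → ℝ≥0) (l : ℝ≥0∞) (P : Set S)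
    (B : S → Finset A) : (S → ℝ≥0∞) →o (S → ℝ≥0∞) where
  toFun w s :=
    if s ∈ P then ⨆ a ∈ B s, backup δ ρ l w s a else ⨅ a ∈ B s, backup δ ρ l w s a
  monotone' w w' h s := by
    dsimp only
    split_ifs
    · exact iSup₂_mono fun a _ => backup_mono δ ρ le_rfl h s a
    · exact iInf₂_mono fun a _ => backup_mono δ ρ le_rfl h s a

/-- The value of the game, as the least fixed point of its Bellman operator. -/
noncomputable def gameValue (δ : S → A → PMF S) (ρ : S → A → ℝ≥0) (l : ℝ≥0∞) (P : Set S)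
    (B : S → Finset A) : S → ℝ≥0∞ :=
  (gameOp δ ρ l P B).lfp

section GameValue

variable {δ : S → A → PMF S} {ρ : S → A → ℝ≥0} {l : ℝ≥0∞} {P : Set S} {B : S → Finset A}

lemma backup_le_gameOp {w : S → ℝ≥0∞} {s : S} (hs : s ∈ P) {a : A} (ha : a ∈ B s) :
    backup δ ρ l w s a ≤ gameOp δ ρ l P B w s := by
  classical
  change _ ≤ ite _ _ _
  rw [if_pos hs]
  exact le_iSup₂ (f := fun a _ => backup δ ρ l w s a) a ha

lemma gameOp_le_backup {w : S → ℝ≥0∞} {s : S} (hs : s ∉ P) {a : A} (ha : a ∈ B s) :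
    gameOp δ ρ l P B w s ≤ backup δ ρ l w s a := by
  classical
  change ite _ _ _ ≤ _
  rw [if_neg hs]
  exact iInf₂_le (f := fun a _ => backup δ ρ l w s a) a ha

lemma gameOp_le_of_forall {w : S → ℝ≥0∞} {s : S} (hs : s ∈ P) {c : ℝ≥0∞}
    (h : ∀ a ∈ B s, backup δ ρ l w s a ≤ c) : gameOp δ ρ l P B w s ≤ c := by
  classical
  change ite _ _ _ ≤ _
  rw [if_pos hs]
  exact iSup₂_le h

lemma exists_gameOp_eq_backup (hB : ∀ s, (B s).Nonempty) (w : S → ℝ≥0∞) :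
    ∃ f : S → A, ∀ s, f s ∈ B s ∧ gameOp δ ρ l P B w s = backup δ ρ l w s (f s) := by
  have key : ∀ s, ∃ a ∈ B s, gameOp δ ρ l P B w s = backup δ ρ l w s a := by
    intro s
    by_cases hs : s ∈ P
    · obtain ⟨a, ha, hmax⟩ := (B s).exists_max_image (backup δ ρ l w s) (hB s)
      exact ⟨a, ha, (gameOp_le_of_forall hs hmax).antisymm (backup_le_gameOp hs ha)⟩
    · obtain ⟨a, ha, hmin⟩ := (B s).exists_min_image (backup δ ρ l w s) (hB s)
      refine ⟨a, ha, (gameOp_le_backup hs ha).antisymm ?_⟩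
      classical
      change _ ≤ ite _ _ _
      rw [if_neg hs]
      exact le_iInf₂ hmin
  choose f hf using key
  exact ⟨f, hf⟩

lemma gameOp_gameValue : gameOp δ ρ l P B (gameValue δ ρ l P B) = gameValue δ ρ l P B :=
  OrderHom.map_lfp _

lemma backup_le_gameValue {s : S} (hs : s ∈ P) {a : A} (ha : a ∈ B s) :
    backup δ ρ l (gameValue δ ρ l P B) s a ≤ gameValue δ ρ l P B s := by
  conv_rhs => rw [← gameOp_gameValue]
  exact backup_le_gameOp hs ha

lemma gameValue_le_backup {s : S} (hs : s ∉ P) {a : A} (ha : a ∈ B s) :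
    gameValue δ ρ l P B s ≤ backup δ ρ l (gameValue δ ρ l P B) s a := by
  conv_lhs => rw [← gameOp_gameValue]
  exact gameOp_le_backup hs ha

lemma gameValue_le {w : S → ℝ≥0∞} (h : ∀ s, gameOp δ ρ l P B w s ≤ w s) :
    gameValue δ ρ l P B ≤ w :=
  OrderHom.lfp_le _ h

lemma exists_gameValue_eq_backup (hB : ∀ s, (B s).Nonempty) :
    ∃ f : S → A, ∀ s, f s ∈ B s ∧
      gameValue δ ρ l P B s = backup δ ρ l (gameValue δ ρ l P B) s (f s) := by
  obtain ⟨f, hf⟩ := exists_gameOp_eq_backup (δ := δ) (ρ := ρ) (l := l) (P := P) hB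
    (gameValue δ ρ l P B)
  refine ⟨f, fun s => ⟨(hf s).1, ?_⟩⟩
  rw [← (hf s).2, gameOp_gameValue]

lemma gameValue_mono_discount {l' : ℝ≥0∞} (hl : l ≤ l') :
    gameValue δ ρ l P B ≤ gameValue δ ρ l' P B := by
  refine gameValue_le fun s => ?_
  conv_rhs => rw [← gameOp_gameValue]
  classical
  change ite _ _ _ ≤ ite _ _ _
  split_ifs
  · exact iSup₂_mono fun a _ => backup_mono δ ρ hl le_rfl s a
  · exact iInf₂_mono fun a _ => backup_mono δ ρ hl le_rfl s a

lemma backup_add_const (w : S → ℝ≥0∞) (M : ℝ≥0∞) (s : S) (a : A) :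
    backup δ ρ l (fun t => w t + M) s a = backup δ ρ l w s a + l * M := by
  simp only [backup, mul_add, Finset.sum_add_distrib, sum_pmf_mul_const, add_assoc]

variable [Fintype A]

lemma gameValue_ne_top (hB : ∀ s, (B s).Nonempty) (hl : l < 1) (s : S) :
    gameValue δ ρ l P B s ≠ ⊤ := by
  have h1 : 1 - l ≠ 0 := (tsub_pos_of_lt hl).ne'
  have h1' : 1 - l ≠ ⊤ := ENNReal.sub_ne_top ENNReal.one_ne_top
  let C : ℝ≥0∞ := ∑ s, ∑ a, (ρ s a : ℝ≥0∞)
  have hC : C ≠ ⊤ := by simp [C, ENNReal.sum_eq_top]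
  have hρ : ∀ s a, (ρ s a : ℝ≥0∞) ≤ C := fun s a =>
    (Finset.single_le_sum (f := fun a => (ρ s a : ℝ≥0∞)) (fun _ _ => zero_le)
      (Finset.mem_univ a)).trans
    (Finset.single_le_sum (f := fun s => ∑ a, (ρ s a : ℝ≥0∞)) (fun _ _ => zero_le)
      (Finset.mem_univ s))
  -- the constant `C / (1 - l)` bounds the discounted sum of rewards that are at most `C`
  have hK : gameValue δ ρ l P B ≤ fun _ => C * (1 - l)⁻¹ := by
    refine gameValue_le fun s => ?_
    obtain ⟨f, hf⟩ := exists_gameOp_eq_backup (δ := δ) (ρ := ρ) (l := l) (P := P) hB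
      fun _ => C * (1 - l)⁻¹
    rw [(hf s).2, backup, sum_pmf_mul_const]
    calc (ρ s (f s) : ℝ≥0∞) + l * (C * (1 - l)⁻¹)
        ≤ C * ((1 - l) * (1 - l)⁻¹) + l * (C * (1 - l)⁻¹) := by
          rw [ENNReal.mul_inv_cancel h1 h1', mul_one]
          gcongr
          exact hρ _ _
      _ = C * (1 - l)⁻¹ * ((1 - l) + l) := by ring
      _ = C * (1 - l)⁻¹ := by rw [tsub_add_cancel_of_le hl.le, mul_one]
  exact ((hK s).trans_lt (ENNReal.mul_lt_top hC.lt_top (ENNReal.inv_lt_top.2 h1.bot_lt))).ne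

/-- With discounting, a finite sub-solution of the Bellman equations is a lower bound: the excess
over the value is contracted by the factor `l`. -/
lemma le_policyValue_of_discount (hl : l < 1) {μ : S → PMF A} {v : S → ℝ≥0∞}
    (hv : ∀ s, v s ≠ ⊤) (h : ∀ s, ∀ a ∈ (μ s).support, v s ≤ backup δ ρ l v s a) :
    v ≤ policyValue δ ρ l μ := by
  set E := policyValue δ ρ l μ
  let M : ℝ≥0∞ := ⨆ s, (v s - E s)
  have hM : M ≠ ⊤ := by
    refine ne_top_of_le_ne_top (ENNReal.sum_ne_top.2 fun s (_ : s ∈ Finset.univ) => hv s)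
      (iSup_le fun s => tsub_le_self.trans
        (Finset.single_le_sum (f := v) (fun _ _ => zero_le) (Finset.mem_univ s)))
  have hvE : v ≤ fun s => E s + M := fun s =>
    tsub_le_iff_left.1 (le_iSup (fun s => v s - E s) s)
  have hMl : M ≤ l * M := by
    refine iSup_le fun s => tsub_le_iff_left.2 ?_
    calc v s ≤ ∑ a, μ s a * backup δ ρ l v s a := le_sum_pmf_mul _ (h s)
      _ ≤ ∑ a, μ s a * backup δ ρ l (fun t => E t + M) s a := by
          gcongr with a
          exact backup_mono δ ρ le_rfl hvE s a
      _ = E s + l * M := by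
          simp only [backup_add_const, mul_add, Finset.sum_add_distrib, sum_pmf_mul_const]
          rw [← policyValue_eq]
  have hM0 : M = 0 := by
    by_contra h0
    have := ENNReal.mul_lt_mul_left h0 hM hl
    rw [one_mul] at this
    exact absurd hMl (not_le.2 this)
  intro s
  simpa [hM0] using hvE s

/-- The minimiser has a pure memoryless strategy that keeps the total reward down to the value. -/
theorem exists_minimiser (hB : ∀ s, (B s).Nonempty) :
    ∃ g : S → A, (∀ s, g s ∈ B s) ∧ ∀ μ : S → PMF A,
      (∀ s, ∀ a ∈ (μ s).support, a ∈ B s ∧ (s ∉ P → a = g s)) →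
        policyValue δ ρ l μ ≤ gameValue δ ρ l P B := by
  obtain ⟨g, hg⟩ := exists_gameValue_eq_backup (δ := δ) (ρ := ρ) (l := l) (P := P) hB
  refine ⟨g, fun s => (hg s).1, fun μ hμ => policyValue_le fun s =>
    sum_pmf_mul_le _ fun a ha => ?_⟩
  by_cases hs : s ∈ P
  · exact backup_le_gameValue hs (hμ s a ha).1
  · rw [(hμ s a ha).2 hs]
    exact (hg s).2.ge

open Filter Topology in
/-- The maximiser has a pure memoryless strategy that guarantees the value. A greedy strategy for
the undiscounted value may idle forever without collecting it; a strategy that is optimal for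
discount factors arbitrarily close to `1`, which exists because there are only finitely many pure
memoryless strategies, does not. -/
theorem exists_maximiser (hB : ∀ s, (B s).Nonempty) :
    ∃ f : S → A, (∀ s, f s ∈ B s) ∧ ∀ μ : S → PMF A,
      (∀ s, ∀ a ∈ (μ s).support, a ∈ B s ∧ (s ∈ P → a = f s)) →
        gameValue δ ρ 1 P B ≤ policyValue δ ρ 1 μ := by
  let d : ℕ → ℝ≥0∞ := fun n => 1 - 2⁻¹ ^ n
  have hd1 : ∀ n, d n < 1 := fun n =>
    ENNReal.sub_lt_self ENNReal.one_ne_top one_ne_zero (pow_ne_zero n (by simp))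
  have hdmono : Monotone d := fun m n hmn =>
    tsub_le_tsub_left (pow_le_pow_right_of_le_one' (by simp) hmn) 1
  have hdlim : Tendsto d atTop (𝓝 1) := by
    have := ENNReal.Tendsto.sub (tendsto_const_nhds (x := (1 : ℝ≥0∞)) (f := atTop (α := ℕ)))
      (ENNReal.tendsto_pow_atTop_nhds_zero_of_lt_one (r := 2⁻¹) (by simp))
      (Or.inl ENNReal.one_ne_top)
    simpa using this
  let v : ℕ → S → ℝ≥0∞ := fun n => gameValue δ ρ (d n) P B
  have hvmono : Monotone v := fun m n hmn => gameValue_mono_discount (hdmono hmn)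
  let V : S → ℝ≥0∞ := fun s => ⨆ n, v n s
  have hvV : ∀ n, v n ≤ V := fun n s => le_iSup (fun n => v n s) n
  have hlim : ∀ s a, Tendsto (fun n => backup δ ρ (d n) (v n) s a) atTop
      (𝓝 (backup δ ρ 1 V s a)) := by
    intro s a
    have hvlim : ∀ t, Tendsto (fun n => v n t) atTop (𝓝 (V t)) := fun t =>
      tendsto_atTop_iSup fun m n hmn => hvmono hmn t
    refine tendsto_const_nhds.add (ENNReal.Tendsto.mul hdlim (Or.inl one_ne_zero) ?_
      (Or.inr ENNReal.one_ne_top))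
    exact tendsto_finsetSum _ fun t _ =>
      ENNReal.Tendsto.const_mul (hvlim t) (Or.inr (PMF.apply_ne_top _ _))
  choose F hF using fun n => exists_gameValue_eq_backup (δ := δ) (ρ := ρ) (l := d n) (P := P) hB
  obtain ⟨f, hf⟩ := Finite.exists_infinite_fiber F
  have hfreq : ∃ᶠ n in atTop, F n = f :=
    Nat.frequently_atTop_iff_infinite.2 (Set.infinite_coe_iff.1 hf)
  refine ⟨f, ?_, fun μ hμ => ?_⟩
  · obtain ⟨n, rfl⟩ := hfreq.exists
    exact fun s => (hF n s).1
  -- the limit of the discounted values is a super-solution of the undiscounted Bellman equations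
  have hV : gameValue δ ρ 1 P B ≤ V := by
    refine gameValue_le fun s => ?_
    by_cases hs : s ∈ P
    · refine gameOp_le_of_forall hs fun a ha => le_of_tendsto' (hlim s a) fun n => ?_
      exact (backup_le_gameValue hs ha).trans (hvV n s)
    · have hfs : f s ∈ B s := by
        obtain ⟨n, rfl⟩ := hfreq.exists
        exact (hF n s).1
      refine (gameOp_le_backup hs hfs).trans
        (le_of_tendsto_of_frequently (hlim s (f s)) (hfreq.mono fun n hn => ?_))
      rw [← hn]
      exact (hF n s).2.ge.trans (hvV n s)
  refine hV.trans fun s => iSup_le fun n => ?_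
  obtain ⟨m, hnm, hm⟩ := hfreq.forall_exists_of_atTop n
  refine (hvmono hnm s).trans ((le_policyValue_of_discount (hd1 m)
    (fun s => gameValue_ne_top hB (hd1 m) s) (fun s a ha => ?_)).trans
    (policyValue_mono_discount δ ρ (hd1 m).le μ) s)
  by_cases hs : s ∈ P
  · rw [(hμ s a ha).2 hs, ← hm]
    exact (hF m s).2.le
  · exact gameValue_le_backup hs (hμ s a ha).1

end GameValue

end PermissiveSynthesis

/-! ### Deterministic multi-strategies -/

namespace PermissiveSynthesis
namespace StochasticGame

variable {S A : Type*} (G : StochasticGame S A)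

/-- `B` gives, for every state, the set of actions left available by a deterministic
multi-strategy; environment states are not restricted. -/
structure IsSelection (B : S → Finset A) : Prop where
  nonempty : ∀ s, (B s).Nonempty
  subset : ∀ s, B s ⊆ G.enabled s
  environment : ∀ s ∉ G.controller, B s = G.enabled s

variable {G} {B : S → Finset A}

/-- The deterministic multi-strategy allowing the actions in `B s` in the controller state `s`. -/
noncomputable def detMulti (hB : G.IsSelection B) : G.MultiStrategy where
  choice s := PMF.pure (B s)
  support_subset s C hC := by
    rw [PMF.support_pure, Set.mem_singleton_iff] at hC
    exact hC ▸ ⟨hB.nonempty s, hB.subset s⟩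

lemma isDeterministic_detMulti (hB : G.IsSelection B) : (detMulti hB).IsDeterministic :=
  fun s => ⟨B s, rfl⟩

lemma MultiStrategy.IsDeterministic.exists_eq_detMulti {θ : G.MultiStrategy}
    (hθ : θ.IsDeterministic) : ∃ (B : S → Finset A) (hB : G.IsSelection B), θ = detMulti hB := by
  classical
  choose C hC using hθ
  have hCs : ∀ s, (C s).Nonempty ∧ C s ⊆ G.enabled s := fun s =>
    θ.support_subset s _ (by simp [hC])
  refine ⟨fun s => if h : s ∈ G.controller then C ⟨s, h⟩ else G.enabled s, ⟨?_, ?_, ?_⟩, ?_⟩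
  · intro s
    split_ifs with h
    · exact (hCs ⟨s, h⟩).1
    · exact G.enabled_nonempty s
  · intro s
    split_ifs with h
    · exact (hCs ⟨s, h⟩).2
    · exact subset_rfl
  · intro s h
    simp [h]
  · obtain ⟨c, hc⟩ := θ
    simp only [detMulti, MultiStrategy.mk.injEq]
    funext s
    rw [dif_pos s.2]
    exact hC s

lemma complies_detMulti_iff (hB : G.IsSelection B) (σ : G.Strategy G.controller) :
    Complies σ (detMulti hB) ↔ ∀ s : G.controller, ∀ a ∈ (σ.choice s).support, a ∈ B s := by
  classical
  constructor
  · intro h s a ha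
    obtain ⟨d, -, hd⟩ := h s
    by_contra hna
    refine (PMF.mem_support_iff _ _).1 ha ?_
    rw [hd a (σ.support_subset s a ha)]
    refine Finset.sum_eq_zero fun C hC => ?_
    have hne : C ≠ B s := by
      rintro rfl
      exact hna (Finset.mem_filter.1 hC).2
    simp [detMulti, PMF.pure_apply, hne]
  · intro h s
    refine ⟨fun C => if hC : C = B s ∨ ¬ C.Nonempty then σ.choice s
      else PMF.pure (not_not.1 (not_or.1 hC).2).choose, ?_, ?_⟩
    · intro C hne _ a ha
      dsimp only at ha
      split_ifs at ha with hC
      · obtain rfl := hC.resolve_right (not_not.2 hne)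
        exact h s a ha
      · rw [PMF.support_pure, Set.mem_singleton_iff] at ha
        subst ha
        exact Exists.choose_spec (p := fun x => x ∈ C) _
    · intro a ha
      by_cases haB : a ∈ B s
      · rw [Finset.sum_eq_single (B s)]
        · simp [detMulti]
        · intro C _ hne
          simp [detMulti, PMF.pure_apply, hne]
        · intro hn
          simp [hB.subset, haB] at hn
      · rw [Finset.sum_eq_zero]
        · by_contra h0
          exact haB (h s a ((PMF.mem_support_iff _ _).2 h0))
        · intro C hC
          have hne : C ≠ B s := by
            rintro rfl
            exact haB (Finset.mem_filter.1 hC).2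
          simp [detMulti, PMF.pure_apply, hne]

lemma actionDist_controller (σ : G.Strategy G.controller) (π : G.Strategy G.controllerᶜ) {s : S}
    (hs : s ∈ G.controller) : G.actionDist σ π s = σ.choice ⟨s, hs⟩ :=
  dif_pos hs

lemma actionDist_environment (σ : G.Strategy G.controller) (π : G.Strategy G.controllerᶜ) {s : S}
    (hs : s ∉ G.controller) : G.actionDist σ π s = π.choice ⟨s, hs⟩ :=
  dif_neg hs

lemma mem_enabled_of_mem_support (σ : G.Strategy G.controller) (π : G.Strategy G.controllerᶜ)
    {s : S} {a : A} (ha : a ∈ (G.actionDist σ π s).support) : a ∈ G.enabled s := by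
  by_cases hs : s ∈ G.controller
  · rw [actionDist_controller σ π hs] at ha
    exact σ.support_subset _ a ha
  · rw [actionDist_environment σ π hs] at ha
    exact π.support_subset _ a ha

lemma mem_of_complies (hB : G.IsSelection B) {σ : G.Strategy G.controller}
    (hσ : Complies σ (detMulti hB)) (π : G.Strategy G.controllerᶜ) {s : S} {a : A}
    (ha : a ∈ (G.actionDist σ π s).support) : a ∈ B s := by
  by_cases hs : s ∈ G.controller
  · rw [actionDist_controller σ π hs] at ha
    exact (complies_detMulti_iff hB σ).1 hσ _ a ha
  · rw [hB.environment s hs]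
    exact mem_enabled_of_mem_support σ π ha

lemma exists_complies_pure (hB : G.IsSelection B) {f : S → A} (hf : ∀ s, f s ∈ B s) :
    ∃ (σ : G.Strategy G.controller) (π : G.Strategy G.controllerᶜ), Complies σ (detMulti hB) ∧
      ∀ s, G.actionDist σ π s = PMF.pure (f s) := by
  refine ⟨⟨fun s => PMF.pure (f s), ?_⟩, ⟨fun s => PMF.pure (f s), ?_⟩, ?_, ?_⟩
  · intro s a ha
    rw [PMF.support_pure, Set.mem_singleton_iff] at ha
    exact ha ▸ hB.subset s (hf s)
  · intro s a ha
    rw [PMF.support_pure, Set.mem_singleton_iff] at ha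
    exact ha ▸ hB.subset s (hf s)
  · rw [complies_detMulti_iff]
    intro s a ha
    rw [PMF.support_pure, Set.mem_singleton_iff] at ha
    exact ha ▸ hf s
  · intro s
    by_cases hs : s ∈ G.controller
    · rw [actionDist_controller _ _ hs]
    · rw [actionDist_environment _ _ hs]

lemma exists_complies (θ : G.MultiStrategy) : ∃ σ : G.Strategy G.controller, Complies σ θ := by
  classical
  have hd : ∀ (s : S) (C : Finset A), ∃ d : PMF A, C.Nonempty → ∀ a ∈ d.support, a ∈ C := by
    intro s C
    by_cases hC : C.Nonempty
    · refine ⟨PMF.pure hC.choose, fun _ a ha => ?_⟩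
      rw [PMF.support_pure, Set.mem_singleton_iff] at ha
      exact ha ▸ hC.choose_spec
    · exact ⟨PMF.pure (G.enabled_nonempty s).choose, fun h => absurd h hC⟩
  choose d hd using hd
  refine ⟨⟨fun s => (θ.choice s).bind (d s), ?_⟩, fun s => ⟨d s, fun C hne _ => hd s C hne, ?_⟩⟩
  · intro s a ha
    obtain ⟨C, hC, haC⟩ := (PMF.mem_support_bind_iff _ _ _).1 ha
    obtain ⟨hne, hsub⟩ := θ.support_subset s C hC
    exact hsub (hd s C hne a haC)
  · intro a ha
    rw [PMF.bind_apply]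
    refine tsum_eq_sum fun C hC => ?_
    by_cases h0 : C ∈ (θ.choice s).support
    · obtain ⟨hne, hsub⟩ := θ.support_subset s C h0
      have haC : a ∉ C := fun haC =>
        hC (Finset.mem_filter.2 ⟨Finset.mem_powerset.2 hsub, haC⟩)
      rw [(PMF.apply_eq_zero_iff _ a).2 fun h => haC (hd s C hne a h), mul_zero]
    · rw [(PMF.apply_eq_zero_iff _ C).2 h0, zero_mul]

variable [Fintype A] [Fintype S]

lemma sound_detMulti_iff (hB : G.IsSelection B) (r : S → A → ℝ≥0) (b : ℝ) :
    (detMulti hB).Sound r b ↔ ENNReal.ofReal b ≤ gameValue G.δ r 1 ∅ B G.init := by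
  constructor
  · intro h
    obtain ⟨g, hg, hmin⟩ := exists_minimiser (δ := G.δ) (ρ := r) (l := 1) (P := ∅) hB.nonempty
    obtain ⟨σ, π, hσ, hf⟩ := exists_complies_pure hB hg
    refine (h σ hσ π).trans ?_
    rw [expectedReward_eq_policyValue]
    refine hmin _ (fun s a ha => ?_) _
    rw [hf, PMF.support_pure, Set.mem_singleton_iff] at ha
    exact ⟨ha ▸ hg s, fun _ => ha⟩
  · intro h σ hσ π
    obtain ⟨f, -, hmax⟩ := exists_maximiser (δ := G.δ) (ρ := r) (P := ∅) hB.nonempty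
    refine h.trans ?_
    rw [expectedReward_eq_policyValue]
    exact hmax _ (fun s a ha => ⟨mem_of_complies hB hσ π ha, fun h => h.elim⟩) _

lemma dynPenalty_detMulti (hB : G.IsSelection B) (ψ : G.controller → A → ℝ≥0) (s : S) :
    (detMulti hB).dynPenalty ψ s =
      gameValue G.δ ((detMulti hB).penaltyReward ψ) 1 Set.univ B s := by
  apply le_antisymm
  · refine iSup_le fun σ => iSup_le fun π => iSup_le fun hσ => ?_
    obtain ⟨g, -, hmin⟩ := exists_minimiser (δ := G.δ) (ρ := (detMulti hB).penaltyReward ψ)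
      (l := 1) (P := Set.univ) hB.nonempty
    rw [expectedReward_eq_policyValue]
    exact hmin _ (fun s a ha =>
      ⟨mem_of_complies hB hσ π ha, fun h => absurd (Set.mem_univ s) h⟩) _
  · obtain ⟨f, hf, hmax⟩ := exists_maximiser (δ := G.δ) (ρ := (detMulti hB).penaltyReward ψ)
      (P := Set.univ) hB.nonempty
    obtain ⟨σ, π, hσ, hμ⟩ := exists_complies_pure hB hf
    refine le_trans ?_ (le_iSup_of_le σ (le_iSup_of_le π (le_iSup_of_le hσ le_rfl)))
    rw [expectedReward_eq_policyValue]
    refine hmax _ (fun s a ha => ?_) _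
    rw [hμ, PMF.support_pure, Set.mem_singleton_iff] at ha
    exact ⟨ha ▸ hf s, fun _ => ha⟩

/-- Randomisation in multi-strategies does not help soundness: the value of the game in which the
controller maximises and the environment minimises is at least `b`, and a pure memoryless strategy
of the controller attains it. -/
theorem exists_sound_detMulti {r : S → A → ℝ≥0} {b : ℝ} {θ : G.MultiStrategy}
    (hθ : θ.Sound r b) :
    ∃ (B : S → Finset A) (hB : G.IsSelection B), (detMulti hB).Sound r b := by
  classical
  -- `g` is a best response of the environment, so any compliant strategy bounds the value below
  obtain ⟨σ, hσ⟩ := exists_complies θ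
  obtain ⟨g, hg, hmin⟩ := exists_minimiser (δ := G.δ) (ρ := r) (l := 1) (P := G.controller)
    G.enabled_nonempty
  obtain ⟨f, hf, hmax⟩ := exists_maximiser (δ := G.δ) (ρ := r) (P := G.controller)
    G.enabled_nonempty
  have hval : ENNReal.ofReal b ≤ gameValue G.δ r 1 G.controller G.enabled G.init := by
    let π : G.Strategy G.controllerᶜ := ⟨fun s => PMF.pure (g s), fun s a ha => by
      rw [PMF.support_pure, Set.mem_singleton_iff] at ha
      exact ha ▸ hg s⟩
    refine (hθ σ hσ π).trans ?_
    rw [expectedReward_eq_policyValue]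
    refine hmin _ (fun s a ha => ⟨mem_enabled_of_mem_support σ π ha, fun hs => ?_⟩) _
    rw [actionDist_environment σ π hs, PMF.support_pure, Set.mem_singleton_iff] at ha
    exact ha
  have hB : G.IsSelection fun s => if s ∈ G.controller then {f s} else G.enabled s := by
    refine ⟨fun s => ?_, fun s => ?_, fun s hs => if_neg hs⟩
    · split_ifs
      · exact Finset.singleton_nonempty _
      · exact G.enabled_nonempty s
    · split_ifs
      · exact Finset.singleton_subset_iff.2 (hf s)
      · exact subset_rfl
  refine ⟨_, hB, fun σ' hσ' π' => hval.trans ?_⟩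
  rw [expectedReward_eq_policyValue]
  refine hmax _ (fun s a ha => ⟨mem_enabled_of_mem_support σ' π' ha, fun hs => ?_⟩) _
  have := mem_of_complies hB hσ' π' ha
  rwa [if_pos hs, Finset.mem_singleton] at this

theorem exists_optimallyPermissive {r : S → A → ℝ≥0} {b : ℝ} (ψ : G.controller → A → ℝ≥0)
    (h : ∃ θ : G.MultiStrategy, θ.Sound r b) :
    ∃ θ : G.MultiStrategy, θ.OptimallyPermissive r b ψ := by
  obtain ⟨θ, hθ⟩ := h
  obtain ⟨B₀, hB₀, hs₀⟩ := exists_sound_detMulti hθ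
  let T := {B : S → Finset A // ∃ hB : G.IsSelection B, (detMulti hB).Sound r b}
  have : Nonempty T := ⟨⟨B₀, hB₀, hs₀⟩⟩
  obtain ⟨⟨B, hB, hs⟩, hmin⟩ :=
    Finite.exists_min fun C : T => (detMulti C.2.choose).dynPenalty ψ G.init
  refine ⟨detMulti hB, isDeterministic_detMulti hB, hs, le_antisymm ?_ ?_⟩
  · refine le_iInf fun θ' => le_iInf fun hdet => le_iInf fun hsound => ?_
    obtain ⟨C, hC, rfl⟩ := hdet.exists_eq_detMulti
    exact hmin ⟨C, hC, hsound⟩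
  · exact iInf_le_of_le _ (iInf_le_of_le (isDeterministic_detMulti hB) (iInf_le _ hs))

end StochasticGame
end PermissiveSynthesis

/-! ### From feasible assignments to multi-strategies -/

namespace PermissiveSynthesis

section Real

variable {X : Type*} [Fintype X]

lemma sum_toReal_mul_const (p : PMF X) (c : ℝ) : ∑ x, (p x).toReal * c = c := by
  have h := sum_pmf_mul_const p 1
  simp only [mul_one] at h
  rw [← Finset.sum_mul, ← ENNReal.toReal_sum fun x _ => p.apply_ne_top x, h, ENNReal.toReal_one,
    one_mul]

lemma sum_toReal_mul_mono (p : PMF X) {f g : X → ℝ} (h : ∀ x ∈ p.support, f x ≤ g x) :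
    ∑ x, (p x).toReal * f x ≤ ∑ x, (p x).toReal * g x := by
  refine Finset.sum_le_sum fun x _ => ?_
  by_cases hx : x ∈ p.support
  · exact mul_le_mul_of_nonneg_left (h x hx) ENNReal.toReal_nonneg
  · simp [(p.apply_eq_zero_iff x).2 hx]

/-- An average reaches an upper bound only if all averaged values do. -/
lemma eq_of_le_sum_toReal_mul (p : PMF X) {f : X → ℝ} {M : ℝ} (hf : ∀ x ∈ p.support, f x ≤ M)
    (hM : M ≤ ∑ x, (p x).toReal * f x) {x : X} (hx : x ∈ p.support) : f x = M := by
  refine (hf x hx).antisymm (not_lt.1 fun hlt => hM.not_gt ?_)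
  conv_rhs => rw [← sum_toReal_mul_const p M]
  refine Finset.sum_lt_sum (fun y _ => ?_) ⟨x, Finset.mem_univ x, ?_⟩
  · by_cases hy : y ∈ p.support
    · exact mul_le_mul_of_nonneg_left (hf y hy) ENNReal.toReal_nonneg
    · simp [(p.apply_eq_zero_iff y).2 hy]
  · exact mul_lt_mul_of_pos_left hlt (ENNReal.toReal_pos hx (p.apply_ne_top x))

lemma eq_of_sum_toReal_mul_le (p : PMF X) {f : X → ℝ} {M : ℝ} (hf : ∀ x ∈ p.support, M ≤ f x)
    (hM : ∑ x, (p x).toReal * f x ≤ M) {x : X} (hx : x ∈ p.support) : f x = M := by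
  have := eq_of_le_sum_toReal_mul p (f := fun x => -f x) (M := -M)
    (fun x hx => neg_le_neg (hf x hx)) (by simpa using hM) hx
  exact neg_injective this

end Real

section Ranking

variable {S A : Type*} [Fintype S] {δ : S → A → PMF S} {r : S → A → ℝ≥0}

lemma backup_ofReal {w : S → ℝ} (hw : ∀ t, 0 ≤ w t) (s : S) (a : A) :
    backup δ r 1 (fun t => ENNReal.ofReal (w t)) s a =
      ENNReal.ofReal (r s a + ∑ t, (δ s a t).toReal * w t) := by
  have h : ∀ t, 0 ≤ (δ s a t).toReal * w t := fun t => mul_nonneg ENNReal.toReal_nonneg (hw t)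
  rw [backup, one_mul, ENNReal.ofReal_add (NNReal.coe_nonneg (r s a))
      (Finset.sum_nonneg fun t _ => h t),
    ENNReal.ofReal_coe_nnreal, ENNReal.ofReal_sum_of_nonneg fun t _ => h t]
  congr 1
  refine Finset.sum_congr rfl fun t _ => ?_
  rw [ENNReal.ofReal_mul ENNReal.toReal_nonneg, ENNReal.ofReal_toReal (PMF.apply_ne_top _ _)]

lemma backup_toReal {w : S → ℝ≥0∞} (hw : ∀ t, w t ≠ ⊤) (s : S) (a : A) :
    backup δ r 1 w s a = ENNReal.ofReal (r s a + ∑ t, (δ s a t).toReal * (w t).toReal) := by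
  rw [← backup_ofReal fun t => ENNReal.toReal_nonneg]
  simp_rw [ENNReal.ofReal_toReal (hw _)]

variable [Fintype A]

/-- A sub-solution `x` of the Bellman equations of a Markov chain is below the expected total reward
if there is a ranking `γ` that forbids to stay forever in states with positive `x` without
collecting rewards. Indeed, the states in which the excess of `x` is maximal are closed under
transitions, and if this excess is positive, then so are the states among them with minimal expected
reward; no reward is collected there, so `γ` has no minimum on them. -/
lemma le_policyValue_of_ranking {μ : S → PMF A} {x γ : S → ℝ}
    (hfin : ∀ s, policyValue δ r 1 μ s ≠ ⊤)
    (hx : ∀ s, ∀ a ∈ (μ s).support, x s ≤ r s a + ∑ t, (δ s a t).toReal * x t)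
    (hγ : ∀ s, 0 < x s → ∀ a ∈ (μ s).support, ∃ t ∈ (δ s a).support, γ t < γ s + r s a) (s : S) :
    x s ≤ (policyValue δ r 1 μ s).toReal := by
  set h : S → ℝ := fun s => (policyValue δ r 1 μ s).toReal with hh
  have hnonneg : ∀ s, 0 ≤ h s := fun s => ENNReal.toReal_nonneg
  have hbell : ∀ s, h s = ∑ a, (μ s a).toReal * (r s a + ∑ t, (δ s a t).toReal * h t) := by
    intro s
    have hpos : ∀ a, 0 ≤ (r s a : ℝ) + ∑ t, (δ s a t).toReal * h t := fun a =>
      add_nonneg (r s a).2 (Finset.sum_nonneg fun t _ =>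
        mul_nonneg ENNReal.toReal_nonneg (hnonneg t))
    simp only [hh] at hpos ⊢
    conv_lhs => rw [policyValue_eq]
    simp_rw [backup_toReal hfin]
    rw [ENNReal.toReal_sum fun a _ => ENNReal.mul_ne_top (PMF.apply_ne_top _ _)
      ENNReal.ofReal_ne_top]
    simp_rw [ENNReal.toReal_mul, ENNReal.toReal_ofReal (hpos _)]
  have : Nonempty S := ⟨s⟩
  obtain ⟨s₀, hs₀⟩ := Finite.exists_max fun s => x s - h s
  set M := x s₀ - h s₀ with hM
  by_contra hlt
  have hMpos : 0 < M := lt_of_lt_of_le (sub_pos.2 (not_le.1 hlt)) (hs₀ s)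
  let T : Set S := {s | x s - h s = M}
  have hTclosed : ∀ s ∈ T, ∀ a ∈ (μ s).support, ∀ t ∈ (δ s a).support, t ∈ T := by
    intro s hs a ha t ht
    have havg : ∀ a ∈ (μ s).support, ∑ t, (δ s a t).toReal * (x t - h t) ≤ M := fun a _ =>
      (sum_toReal_mul_mono _ fun t _ => hs₀ t).trans_eq (sum_toReal_mul_const _ M)
    have hle : M ≤ ∑ a, (μ s a).toReal * ∑ t, (δ s a t).toReal * (x t - h t) := by
      calc M = x s - h s := hs.symm
        _ ≤ ∑ a, (μ s a).toReal * (r s a + ∑ t, (δ s a t).toReal * x t) - h s := by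
            refine sub_le_sub_right ?_ _
            rw [← sum_toReal_mul_const (μ s) (x s)]
            exact sum_toReal_mul_mono _ (hx s)
        _ = _ := by
            rw [hbell s, ← Finset.sum_sub_distrib]
            refine Finset.sum_congr rfl fun a _ => ?_
            simp_rw [mul_sub, Finset.sum_sub_distrib]
            ring
    exact eq_of_le_sum_toReal_mul (δ s a) (fun t _ => hs₀ t)
      (eq_of_le_sum_toReal_mul (μ s) havg hle ha).ge ht
  obtain ⟨s₁, hs₁, hmin⟩ := T.exists_min_image h T.toFinite ⟨s₀, rfl⟩
  let T' : Set S := {s | s ∈ T ∧ h s = h s₁}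
  have hT'closed : ∀ s ∈ T', ∀ a ∈ (μ s).support,
      (r s a : ℝ) = 0 ∧ ∀ t ∈ (δ s a).support, t ∈ T' := by
    intro s hs a ha
    have hge : ∀ a ∈ (μ s).support, h s₁ ≤ ∑ t, (δ s a t).toReal * h t := fun a ha =>
      (sum_toReal_mul_const (δ s a) (h s₁)).symm.trans_le
        (sum_toReal_mul_mono _ fun t ht => hmin t (hTclosed s hs.1 a ha t ht))
    have heq : r s a + ∑ t, (δ s a t).toReal * h t = h s₁ :=
      eq_of_sum_toReal_mul_le (μ s)
        (f := fun a => (r s a : ℝ) + ∑ t, (δ s a t).toReal * h t)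
        (fun a ha => (hge a ha).trans (le_add_of_nonneg_left (r s a).2))
        ((hbell s).symm.trans hs.2).le ha
    have hr0 : (r s a : ℝ) = 0 :=
      le_antisymm (by linarith [hge a ha]) (r s a).2
    refine ⟨hr0, fun t ht => ⟨hTclosed s hs.1 a ha t ht, ?_⟩⟩
    exact eq_of_sum_toReal_mul_le (δ s a) (fun t ht => hmin t (hTclosed s hs.1 a ha t ht))
      (by linarith) ht
  obtain ⟨s₂, hs₂, hγmin⟩ := T'.exists_min_image γ T'.toFinite ⟨s₁, hs₁, rfl⟩
  obtain ⟨a, ha⟩ := (μ s₂).support_nonempty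
  have hxpos : 0 < x s₂ := by
    have : x s₂ - h s₂ = M := hs₂.1
    linarith [hnonneg s₂]
  obtain ⟨t, ht, hlt⟩ := hγ s₂ hxpos a ha
  obtain ⟨hr0, hcl⟩ := hT'closed s₂ hs₂ a ha
  linarith [hγmin t (hcl t ht)]

end Ranking

namespace StochasticGame

lemma sum_mul_one_sub_ite {A : Type*} [DecidableEq A] {E B : Finset A} (h : B ⊆ E) (f : A → ℝ) :
    ∑ a ∈ E, f a * (1 - if a ∈ B then 1 else 0) = ∑ a ∈ E \ B, f a := by
  rw [← Finset.sum_sdiff h, Finset.sum_eq_zero (s := B), add_zero]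
  · refine Finset.sum_congr rfl fun a ha => ?_
    simp [(Finset.mem_sdiff.1 ha).2]
  · intro a ha
    simp [ha]

variable {S A : Type*} {G : StochasticGame S A} {B : S → Finset A}

open Classical in
lemma penaltyReward_detMulti_controller (hB : G.IsSelection B) (ψ : G.controller → A → ℝ≥0)
    (s : G.controller) (a : A) :
    (detMulti hB).penaltyReward ψ s a = ∑ a' ∈ G.enabled s \ B s, ψ s a' := by
  rw [MultiStrategy.penaltyReward, dif_pos s.2, MultiStrategy.localPenalty,
    Finset.sum_eq_single (B s)]
  · simp [detMulti]
  · intro C _ hne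
    simp [detMulti, PMF.pure_apply, hne]
  · intro hn
    exact absurd (Finset.mem_powerset.2 (hB.subset s)) hn

lemma penaltyReward_environment (θ : G.MultiStrategy) (ψ : G.controller → A → ℝ≥0) {s : S}
    (hs : s ∉ G.controller) (a : A) : θ.penaltyReward ψ s a = 0 := by
  rw [MultiStrategy.penaltyReward, dif_neg hs]

variable [Fintype S] [Fintype A]

lemma policyValue_lt_one {r : S → A → ℝ≥0} (hr : ∀ s, G.maxReward r s < 1)
    (σ : G.Strategy G.controller) (π : G.Strategy G.controllerᶜ) (s : S) :
    policyValue G.δ r 1 (G.actionDist σ π) s < 1 := by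
  rw [← expectedReward_eq_policyValue]
  exact (le_iSup₂ (f := fun σ π => G.expectedReward r σ π s) σ π).trans_lt (hr s)

/-- A feasible assignment yields a deterministic multi-strategy by allowing the actions with
`y s a = 1`. It is sound since `x` bounds the rewards from below, and its penalty is at most
`z G.init` since `z` is a super-solution of the Bellman equations for the penalties. -/
theorem Assignment.Feasible.exists_sound {r : S → A → ℝ≥0} (hr : ∀ s, G.maxReward r s < 1)
    {b : ℝ} {ψ : G.controller → A → ℝ≥0} {c : ℝ≥0} {R : ℝ → ℝ → Prop}
    (hR : ∀ p q, R p q → p ≤ q) {v : G.Assignment} (hv : v.Feasible r b ψ c R) :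
    ∃ (B : S → Finset A) (hB : G.IsSelection B), (detMulti hB).Sound r b ∧
      (detMulti hB).dynPenalty ψ G.init ≤ ENNReal.ofReal (v.z G.init) := by
  classical
  let B : S → Finset A := fun s => {a ∈ G.enabled s | v.y s a = 1}
  have hmemB : ∀ s a, a ∈ B s ↔ a ∈ G.enabled s ∧ v.y s a = 1 := fun s a => Finset.mem_filter
  have hB : G.IsSelection B := by
    refine ⟨fun s => ?_, fun s => Finset.filter_subset _ _, fun s hs =>
      Finset.filter_true_of_mem (hv.y_environment s hs)⟩
    by_cases hs : s ∈ G.controller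
    · by_contra hne
      have h0 : ∑ a ∈ G.enabled s, v.y s a = 0 := Finset.sum_eq_zero fun a ha =>
        (hv.y_mem s a).resolve_right fun h1 => hne ⟨a, (hmemB s a).2 ⟨ha, h1⟩⟩
      linarith [hv.some_allowed s hs]
    · obtain ⟨a, ha⟩ := G.enabled_nonempty s
      exact ⟨a, (hmemB s a).2 ⟨ha, hv.y_environment s hs a ha⟩⟩
  refine ⟨B, hB, fun σ hσ π => ?_, ?_⟩
  · have hx := le_policyValue_of_ranking (δ := G.δ) (r := r) (μ := G.actionDist σ π) (x := v.x)
      (γ := v.γ) (fun s => ((policyValue_lt_one hr σ π s).trans ENNReal.one_lt_top).ne) ?_ ?_ G.init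
    · rw [expectedReward_eq_policyValue]
      exact ENNReal.ofReal_le_of_le_toReal (hv.reward_init.trans hx)
    · intro s a ha
      obtain ⟨hen, hy⟩ := (hmemB s a).1 (mem_of_complies hB hσ π ha)
      by_cases hs : s ∈ G.controller
      · have := hv.reward_controller s hs a hen
        linarith
      · have := hv.reward_environment s hs a hen
        linarith
    · intro s hpos a ha
      obtain ⟨hen, hy⟩ := (hmemB s a).1 (mem_of_complies hB hσ π ha)
      have hα : v.α s = 1 := (hv.α_mem s).resolve_left fun h0 => by
        linarith [hv.x_le_α s]
      have hyβ := hR _ _ (hv.y_β s a hen)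
      rw [hy, hα, sub_self, zero_add] at hyβ
      obtain ⟨t, ht, hβ⟩ : ∃ t ∈ (G.δ s a).support, v.β s a t = 1 := by
        by_contra! hno
        have h0 : ∑ t with t ∈ (G.δ s a).support, v.β s a t = 0 :=
          Finset.sum_eq_zero fun t ht =>
            (hv.β_mem s a t).resolve_right (hno t (Finset.mem_filter.1 ht).2)
        linarith
      have := hv.ranking s a hen t ht
      exact ⟨t, ht, by linarith⟩
  · rw [dynPenalty_detMulti]
    refine gameValue_le (w := fun s => ENNReal.ofReal (v.z s)) (fun s =>
      gameOp_le_of_forall (Set.mem_univ s) fun a ha => ?_) G.init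
    obtain ⟨hen, hy⟩ := (hmemB s a).1 ha
    rw [backup_ofReal hv.z_nonneg]
    refine ENNReal.ofReal_le_ofReal ?_
    by_cases hs : s ∈ G.controller
    · have hz := hv.penalty_controller ⟨s, hs⟩ a hen
      have hℓ := hv.local_penalty ⟨s, hs⟩
      have hite : ∀ a ∈ G.enabled s, (ψ ⟨s, hs⟩ a : ℝ) * (1 - v.y s a) =
          ψ ⟨s, hs⟩ a * (1 - if a ∈ B s then 1 else 0) := by
        intro a ha
        by_cases h1 : v.y s a = 1
        · rw [if_pos ((hmemB s a).2 ⟨ha, h1⟩), h1]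
        · rw [if_neg fun h => h1 ((hmemB s a).1 h).2, (hv.y_mem s a).resolve_right h1]
      rw [Finset.sum_congr rfl hite, sum_mul_one_sub_ite (hB.subset s)] at hℓ
      have hpen := penaltyReward_detMulti_controller hB ψ ⟨s, hs⟩ a
      dsimp only at hpen hz
      rw [hpen, NNReal.coe_sum, ← hℓ]
      rw [hy] at hz
      linarith
    · have hz := hv.penalty_environment s hs a hen
      rw [penaltyReward_environment _ _ hs, NNReal.coe_zero, zero_add]
      exact hz

end StochasticGame
end PermissiveSynthesis

/-! ### From multi-strategies to feasible assignments -/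

namespace PermissiveSynthesis

section Traps

variable {S A : Type*} {δ : S → A → PMF S} {r : S → A → ℝ≥0} {B : S → Finset A}

/-- If `N` is a set of states in which one can stay forever without collecting rewards, then the
minimal total reward vanishes on `N`. -/
lemma gameValue_eq_zero_of_trap [Fintype S] {N : Set S}
    (hN : ∀ s ∈ N, ∃ a ∈ B s, r s a = 0 ∧ ∀ t ∈ (δ s a).support, t ∈ N) {s : S} (hs : s ∈ N) :
    gameValue δ r 1 ∅ B s = 0 := by
  classical
  let w : S → ℝ≥0∞ := fun s => if s ∈ N then 0 else gameValue δ r 1 ∅ B s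
  have hw : gameValue δ r 1 ∅ B ≤ w := by
    refine gameValue_le fun s => ?_
    by_cases hs : s ∈ N
    · obtain ⟨a, ha, hr, hcl⟩ := hN s hs
      refine (gameOp_le_backup (Set.notMem_empty s) ha).trans ?_
      rw [backup, hr, ENNReal.coe_zero, zero_add, one_mul]
      exact sum_pmf_mul_le _ fun t ht => by simp [w, hcl t ht]
    · refine ((gameOp δ r 1 ∅ B).mono (b := gameValue δ r 1 ∅ B) (fun t => ?_) s).trans ?_
      · simp only [w]
        split_ifs
        · exact zero_le
        · exact le_rfl
      · rw [gameOp_gameValue]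
        simp [w, hs]
  simpa [w, hs] using hw s

/-- If every set of states in which one can stay forever without collecting rewards meets `D`, then
the states can be ranked such that from every state outside `D` every action without reward may
lead to a state of lower rank. -/
lemma exists_ranking [Fintype A] {D : Set S}
    (htrap : ∀ N : Set S, (∀ s ∈ N, s ∉ D) →
      (∀ s ∈ N, ∃ a ∈ B s, r s a = 0 ∧ ∀ t ∈ (δ s a).support, t ∈ N) → N = ∅) :
    ∃ rank : S → ℕ, ∀ s ∉ D, ∀ a ∈ B s, r s a = 0 → ∃ t ∈ (δ s a).support, rank t < rank s := by
  classical
  -- `W n` is the set of states of rank at most `n`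
  let Φ : Set S → Set S := fun W =>
    {s | s ∈ D ∨ ∀ a ∈ B s, r s a = 0 → ∃ t ∈ (δ s a).support, t ∈ W}
  have hΦ : Monotone Φ := by
    rintro W W' h s (hs | hs)
    · exact Or.inl hs
    · exact Or.inr fun a ha hr => (hs a ha hr).imp fun t ht => ⟨ht.1, h ht.2⟩
  let W : ℕ → Set S := fun n => Φ^[n] ∅
  have hW : ∀ n, W (n + 1) = Φ (W n) := fun n => Function.iterate_succ_apply' Φ n ∅
  have hWmono : Monotone W := hΦ.monotone_iterate_of_le_map (Set.empty_subset _)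
  have hcover : ∀ s, ∃ n, s ∈ W n := by
    have hN := htrap {s | ∀ n, s ∉ W n} ?_ ?_
    · intro s
      by_contra! hs
      exact (Set.eq_empty_iff_forall_notMem.1 hN) s hs
    · intro s hs hD
      refine hs 1 ?_
      rw [hW]
      exact Or.inl hD
    · intro s hs
      by_contra! hno
      have hn : ∀ a, ∃ n, a ∈ B s → r s a = 0 → ∃ t ∈ (δ s a).support, t ∈ W n := by
        intro a
        by_cases h : a ∈ B s ∧ r s a = 0
        · obtain ⟨t, ht, htN⟩ := hno a h.1 h.2
          obtain ⟨n, hn⟩ := not_forall_not.1 htN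
          exact ⟨n, fun _ _ => ⟨t, ht, hn⟩⟩
        · exact ⟨0, fun h1 h2 => absurd ⟨h1, h2⟩ h⟩
      choose n hn using hn
      refine hs (Finset.univ.sup n + 1) ?_
      rw [hW]
      refine Or.inr fun a ha hr => ?_
      obtain ⟨t, ht, htW⟩ := hn a ha hr
      exact ⟨t, ht, hWmono (Finset.le_sup (Finset.mem_univ a)) htW⟩
  refine ⟨fun s => Nat.find (hcover s), fun s hD a ha hr => ?_⟩
  have hs := Nat.find_spec (hcover s)
  cases hn : Nat.find (hcover s) with
  | zero =>
    rw [hn] at hs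
    exact hs.elim
  | succ k =>
    rw [hn, hW] at hs
    obtain ⟨t, ht, htW⟩ := hs.resolve_left hD a ha hr
    exact ⟨t, ht, (Nat.lt_succ_of_le (Nat.find_min' (hcover t) htW)).trans_eq hn.symm⟩

open Filter Topology in
/-- A scaling factor making ranks smaller than `1` and than every positive reward; actions with
positive reward then satisfy the ranking constraint for any successor. -/
lemma exists_small_factor [Finite S] [Finite A] (r : S → A → ℝ≥0) (rank : S → ℕ) :
    ∃ ε : ℝ, 0 < ε ∧ (∀ s, ε * rank s < 1) ∧ ∀ s a t, r s a ≠ 0 → ε * rank t < r s a := by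
  have hlim : ∀ s, Tendsto (fun ε : ℝ => ε * rank s) (𝓝[>] 0) (𝓝 0) := fun s => by
    have : Tendsto (fun ε : ℝ => ε * rank s) (𝓝 0) (𝓝 (0 * rank s)) :=
      tendsto_id.mul_const _
    rw [zero_mul] at this
    exact this.mono_left nhdsWithin_le_nhds
  have h1 : ∀ᶠ ε : ℝ in 𝓝[>] 0, ∀ s, ε * rank s < 1 :=
    eventually_all.2 fun s => (hlim s).eventually (gt_mem_nhds one_pos)
  have h2 : ∀ᶠ ε : ℝ in 𝓝[>] 0, ∀ s a t, r s a ≠ 0 → ε * rank t < r s a := by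
    refine eventually_all.2 fun s => eventually_all.2 fun a => eventually_all.2 fun t => ?_
    by_cases h0 : r s a = 0
    · exact Eventually.of_forall fun _ h => absurd h0 h
    · filter_upwards [(hlim t).eventually (gt_mem_nhds (NNReal.coe_pos.2 (pos_iff_ne_zero.2 h0)))]
        with ε hε _ using hε
  obtain ⟨ε, ⟨hε1, hε2⟩, hε0⟩ := ((h1.and h2).and self_mem_nhdsWithin).exists
  exact ⟨ε, hε0, hε1, hε2⟩

end Traps

namespace StochasticGame

variable {S A : Type*} [Fintype S] {G : StochasticGame S A} {B : S → Finset A}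

/-- The two translations between feasible assignments and sound deterministic multi-strategies give
the correctness of the encoding. -/
lemma encodingCorrect_of_translations {r : S → A → ℝ≥0} {b : ℝ} {ψ : G.controller → A → ℝ≥0}
    {c : ℝ≥0} {R : ℝ → ℝ → Prop} (hopt : ∃ θ : G.MultiStrategy, θ.OptimallyPermissive r b ψ)
    (hdec : ∀ v : G.Assignment, v.Feasible r b ψ c R →
      ∃ (B : S → Finset A) (hB : G.IsSelection B), (detMulti hB).Sound r b ∧
        (detMulti hB).dynPenalty ψ G.init ≤ ENNReal.ofReal (v.z G.init))
    (henc : ∀ θ : G.MultiStrategy, θ.IsDeterministic → θ.Sound r b → θ.dynPenalty ψ G.init ≠ ⊤ →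
      ∃ v : G.Assignment, v.Feasible r b ψ c R ∧ v.z G.init = (θ.dynPenalty ψ G.init).toReal) :
    G.EncodingCorrect r b ψ c R := by
  have hle : ∀ θ : G.MultiStrategy, θ.OptimallyPermissive r b ψ → ∀ v : G.Assignment,
      v.Feasible r b ψ c R → θ.dynPenalty ψ G.init ≤ ENNReal.ofReal (v.z G.init) := by
    intro θ hθ v hv
    obtain ⟨B, hB, hs, hp⟩ := hdec v hv
    rw [hθ.2.2]
    exact iInf_le_of_le _ (iInf_le_of_le (isDeterministic_detMulti hB) (iInf_le_of_le hs hp))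
  refine ⟨⟨fun hno => ?_, ?_⟩, fun p => ⟨?_, ?_⟩⟩
  · obtain ⟨θ, hθ⟩ := hopt
    refine ⟨θ, hθ, by_contra fun hfin => hno ?_⟩
    obtain ⟨v, hv, -⟩ := henc θ hθ.1 hθ.2.1 hfin
    exact ⟨v, hv⟩
  · rintro ⟨θ, hθ, htop⟩ ⟨v, hv⟩
    exact ENNReal.ofReal_ne_top (top_le_iff.1 (htop ▸ hle θ hθ v hv))
  · rintro ⟨⟨v, hv, rfl⟩, hmin⟩
    obtain ⟨θ, hθ⟩ := hopt
    have hfin := ne_top_of_le_ne_top ENNReal.ofReal_ne_top (hle θ hθ v hv)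
    refine ⟨θ, hθ, hfin, le_antisymm ?_ ?_⟩
    · exact ENNReal.toReal_le_of_le_ofReal (hv.z_nonneg _) (hle θ hθ v hv)
    · obtain ⟨v', hv', hz⟩ := henc θ hθ.1 hθ.2.1 hfin
      exact hmin ⟨v', hv', hz.symm⟩
  · rintro ⟨θ, hθ, hfin, rfl⟩
    obtain ⟨v, hv, hz⟩ := henc θ hθ.1 hθ.2.1 hfin
    refine ⟨⟨v, hv, hz.symm⟩, ?_⟩
    rintro _ ⟨v', hv', rfl⟩
    exact ENNReal.toReal_le_of_le_ofReal (hv'.z_nonneg _) (hle θ hθ v' hv')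

variable [Fintype A]

open Classical in
/-- The feasible assignment built from a selection `B`, a lower bound `x` on the rewards, an upper
bound `z` on the penalties and a ranking outside a set `D` of states, in which `α` is set to `0`. In
the other states exactly one successor is chosen for every allowed action. -/
lemma exists_feasible_of_ranking (hB : G.IsSelection B) {r : S → A → ℝ≥0} {b : ℝ}
    {ψ : G.controller → A → ℝ≥0} {c : ℝ≥0} {R : ℝ → ℝ → Prop} (hRrefl : ∀ q, R q q)
    {D : Set S} {rank : S → ℕ} {x z : S → ℝ} (hx : ∀ s, 0 ≤ x s ∧ x s ≤ 1) (hz : ∀ s, 0 ≤ z s)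
    (hinit : b ≤ x G.init)
    (hreward : ∀ s, ∀ a ∈ B s, x s ≤ ∑ t, (G.δ s a t).toReal * x t + r s a)
    (hD : ∀ s ∈ D, x s = 0)
    (hRD : ∀ s ∈ D, ∀ a ∈ G.enabled s, R (if a ∈ B s then 1 else 0) 1)
    (hrank : ∀ s ∉ D, ∀ a ∈ B s, r s a = 0 → ∃ t ∈ (G.δ s a).support, rank t < rank s)
    (hpen : ∀ s : G.controller, ∀ a ∈ G.enabled s,
      ∑ t, (G.δ s a t).toReal * z t + ∑ a' ∈ G.enabled s \ B s, (ψ s a' : ℝ) -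
        (if a ∈ B s then 0 else (c : ℝ)) ≤ z s)
    (hpenEnv : ∀ s ∉ G.controller, ∀ a ∈ G.enabled s, ∑ t, (G.δ s a t).toReal * z t ≤ z s) :
    ∃ v : G.Assignment, v.Feasible r b ψ c R ∧ v.z G.init = z G.init := by
  obtain ⟨ε, hε0, hε1, hεr⟩ := exists_small_factor r rank
  have hsucc : ∀ s a, ∃ t ∈ (G.δ s a).support, s ∉ D → a ∈ B s →
      ε * rank t < ε * rank s + r s a := by
    intro s a
    have hnn : 0 ≤ ε * rank s := by positivity
    by_cases h : s ∉ D ∧ a ∈ B s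
    · by_cases hr : r s a = 0
      · obtain ⟨t, ht, hlt⟩ := hrank s h.1 a h.2 hr
        refine ⟨t, ht, fun _ _ => ?_⟩
        rw [hr, NNReal.coe_zero, add_zero]
        exact mul_lt_mul_of_pos_left (Nat.cast_lt.2 hlt) hε0
      · obtain ⟨t, ht⟩ := (G.δ s a).support_nonempty
        exact ⟨t, ht, fun _ _ => by linarith [hεr s a t hr]⟩
    · obtain ⟨t, ht⟩ := (G.δ s a).support_nonempty
      exact ⟨t, ht, fun h1 h2 => absurd ⟨h1, h2⟩ h⟩
  choose next hnext hlt using hsucc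
  have hite : ∀ (p : Prop) [Decidable p], (if p then (1 : ℝ) else 0) = 0 ∨
      (if p then (1 : ℝ) else 0) = 1 := fun p _ => by
    by_cases hp : p
    · exact Or.inr (if_pos hp)
    · exact Or.inl (if_neg hp)
  refine ⟨{ y := fun s a => if a ∈ B s then 1 else 0
            x := x
            α := fun s => if s ∈ D then 0 else 1
            β := fun s a t => if s ∉ D ∧ a ∈ B s ∧ t = next s a then 1 else 0
            γ := fun s => ε * rank s
            ℓ := fun s => ∑ a ∈ G.enabled s, (ψ s a : ℝ) * (1 - if a ∈ B s then 1 else 0)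
            z := z }, ?_, rfl⟩
  constructor
  case y_mem => exact fun s a => hite _
  case x_mem => exact hx
  case α_mem => exact fun s => by by_cases hs : s ∈ D <;> simp [hs]
  case β_mem => exact fun s a t => hite _
  case γ_mem => exact fun s => ⟨by positivity, (hε1 s).le⟩
  case z_nonneg => exact hz
  case reward_init => exact hinit
  case some_allowed =>
    intro s _
    obtain ⟨a, ha⟩ := hB.nonempty s
    calc (1 : ℝ) = if a ∈ B s then 1 else 0 := (if_pos ha).symm
      _ ≤ _ := Finset.single_le_sum (f := fun a => if a ∈ B s then (1 : ℝ) else 0)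
        (fun a _ => by split_ifs <;> norm_num) (hB.subset s ha)
  case reward_controller =>
    intro s _ a _
    dsimp only
    split_ifs with ha
    · linarith [hreward s a ha]
    · have h1 : 0 ≤ ∑ t, (G.δ s a t).toReal * x t := Finset.sum_nonneg fun t _ =>
        mul_nonneg ENNReal.toReal_nonneg (hx t).1
      have h2 : (0 : ℝ) ≤ r s a := NNReal.coe_nonneg _
      linarith [(hx s).2]
  case reward_environment => exact fun s hs a ha => hreward s a (hB.environment s hs ▸ ha)
  case x_le_α =>
    intro s
    dsimp only
    split_ifs with hs
    · exact (hD s hs).le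
    · exact (hx s).2
  case y_β =>
    intro s a ha
    dsimp only
    by_cases hs : s ∈ D
    · convert! hRD s hs a ha using 1
      simp [hs]
    · by_cases haB : a ∈ B s
      · convert! hRrefl 1 using 1
        · simp [haB]
        · rw [Finset.sum_eq_single_of_mem (next s a) (by simpa using hnext s a)]
          · simp [hs, haB]
          · intro t _ hne
            simp [hne]
      · convert! hRrefl 0 using 1
        · simp [haB]
        · simp [hs, haB]
  case y_environment => exact fun s hs a ha => if_pos (hB.environment s hs ▸ ha)
  case ranking =>
    intro s a _ t _
    dsimp only
    split_ifs with h
    · rw [sub_self, add_zero, h.2.2]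
      exact hlt s a h.1 h.2.1
    · have h1 : 0 ≤ ε * rank s := by positivity
      have h2 : (0 : ℝ) ≤ r s a := NNReal.coe_nonneg _
      linarith [hε1 t]
  case local_penalty => exact fun s => rfl
  case penalty_controller =>
    intro s a ha
    have := hpen s a ha
    dsimp only
    rw [sum_mul_one_sub_ite (hB.subset s)]
    split_ifs at this ⊢ with haB
    · simpa using this
    · simpa using this
  case penalty_environment => exact hpenEnv

/-- A sound deterministic multi-strategy with finite penalty yields a feasible assignment.
The set `U` of states with infinite penalty is not reachable from the initial state, so all actions
may be allowed in `U` without affecting soundness; this makes the local penalties vanish in `U`,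
and `z = c` is large enough there. If the constraint on `y`, `α`, `β` is an equation, then `α = 0`
is only possible in states where all actions are allowed; staying forever in the remaining states
without reward would make the penalty infinite. -/
theorem exists_feasible_of_sound (hB : G.IsSelection B) {r : S → A → ℝ≥0}
    (hr : ∀ s, G.maxReward r s < 1) {b : ℝ} {ψ : G.controller → A → ℝ≥0} {c : ℝ≥0}
    (hc : ∀ s, (detMulti hB).dynPenalty ψ s ≠ ⊤ → (detMulti hB).dynPenalty ψ s ≤ c)
    (hsound : (detMulti hB).Sound r b) (hfin : (detMulti hB).dynPenalty ψ G.init ≠ ⊤)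
    {R : ℝ → ℝ → Prop} (hRrefl : ∀ q, R q q)
    (hR : R 0 1 ∨ ∀ s : G.controller, ∀ a ∈ G.enabled s, ψ s a = 0 → G.enabled s = {a}) :
    ∃ v : G.Assignment, v.Feasible r b ψ c R ∧
      v.z G.init = ((detMulti hB).dynPenalty ψ G.init).toReal := by
  classical
  rw [sound_detMulti_iff] at hsound
  have hpenval : (detMulti hB).dynPenalty ψ =
      gameValue G.δ ((detMulti hB).penaltyReward ψ) 1 Set.univ B :=
    funext fun s => dynPenalty_detMulti hB ψ s
  rw [hpenval] at hc hfin ⊢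
  set ρ := (detMulti hB).penaltyReward ψ with hρ
  set q := gameValue G.δ ρ 1 Set.univ B with hq
  let U : Set S := {s | q s = ⊤}
  have hqB : ∀ s, ∀ a ∈ B s, backup G.δ ρ 1 q s a ≤ q s := fun s a ha =>
    backup_le_gameValue (Set.mem_univ s) ha
  have hUclosed : ∀ s ∉ U, ∀ a ∈ B s, ∀ t ∈ (G.δ s a).support, t ∉ U := by
    intro s hs a ha t ht htU
    refine hs (top_le_iff.1 (le_trans ?_ (hqB s a ha)))
    have h1 : G.δ s a t * q t = ⊤ := by
      rw [show q t = ⊤ from htU, ENNReal.mul_top ((PMF.mem_support_iff _ _).1 ht)]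
    rw [backup, one_mul, ← h1]
    exact (Finset.single_le_sum (f := fun t => G.δ s a t * q t) (fun _ _ => zero_le)
      (Finset.mem_univ t)).trans le_add_self
  let B' : S → Finset A := fun s => if s ∈ U then G.enabled s else B s
  have hB'U : ∀ s ∈ U, B' s = G.enabled s := fun s hs => if_pos hs
  have hB'B : ∀ s ∉ U, B' s = B s := fun s hs => if_neg hs
  have hB' : G.IsSelection B' := by
    refine ⟨fun s => ?_, fun s => ?_, fun s hs => ?_⟩ <;> by_cases hsU : s ∈ U
    · exact hB'U s hsU ▸ G.enabled_nonempty s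
    · exact hB'B s hsU ▸ hB.nonempty s
    · exact (hB'U s hsU).subset
    · exact hB'B s hsU ▸ hB.subset s
    · exact hB'U s hsU
    · exact hB'B s hsU ▸ hB.environment s hs
  set X := gameValue G.δ r 1 ∅ B' with hX
  have hX1 : ∀ s, X s < 1 := by
    obtain ⟨f, hf, hmax⟩ := exists_maximiser (δ := G.δ) (ρ := r) (P := ∅) hB'.nonempty
    obtain ⟨σ, π, hσ, -⟩ := exists_complies_pure hB' hf
    exact fun s => (hmax _ (fun s a ha => ⟨mem_of_complies hB' hσ π ha, fun h => h.elim⟩)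
      s).trans_lt (policyValue_lt_one hr σ π s)
  have hXfin : ∀ s, X s ≠ ⊤ := fun s => ((hX1 s).trans ENNReal.one_lt_top).ne
  -- plays from the initial state do not reach `U`, so the selections `B` and `B'` agree on them
  have hXinit : ENNReal.ofReal b ≤ X G.init := by
    let w : S → ℝ≥0∞ := fun s => if s ∈ U then ⊤ else X s
    have hw : gameValue G.δ r 1 ∅ B ≤ w := by
      refine gameValue_le fun s => ?_
      by_cases hs : s ∈ U
      · simp [w, hs]
      · obtain ⟨f, hf⟩ := exists_gameValue_eq_backup (δ := G.δ) (ρ := r) (l := 1) (P := ∅)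
          hB'.nonempty
        have hfs : f s ∈ B s := hB'B s hs ▸ (hf s).1
        refine (gameOp_le_backup (Set.notMem_empty s) hfs).trans ?_
        simp only [w, hs, if_false]
        rw [hX, (hf s).2, ← hX, backup, backup]
        gcongr 2
        refine (sum_pmf_mul_congr _ fun t ht => ?_).le
        exact if_neg (hUclosed s hs _ hfs t ht)
    refine hsound.trans ((hw G.init).trans_eq ?_)
    exact if_neg hfin
  let z : S → ℝ := fun s => if s ∈ U then c else (q s).toReal
  have hzU : ∀ s ∈ U, z s = c := fun s hs => if_pos hs
  have hzq : ∀ s ∉ U, z s = (q s).toReal := fun s hs => if_neg hs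
  have hz0 : ∀ s, 0 ≤ z s := by
    intro s
    by_cases hs : s ∈ U
    · rw [hzU s hs]
      exact c.2
    · rw [hzq s hs]
      exact ENNReal.toReal_nonneg
  have hzc : ∀ s, z s ≤ c := by
    intro s
    by_cases hs : s ∈ U
    · exact (hzU s hs).le
    · rw [hzq s hs]
      exact ENNReal.toReal_le_coe_of_le_coe (hc s hs)
  have havgc : ∀ s a, ∑ t, (G.δ s a t).toReal * z t ≤ c := fun s a =>
    (sum_toReal_mul_mono _ fun t _ => hzc t).trans_eq (sum_toReal_mul_const _ _)
  have hzB : ∀ s ∉ U, ∀ a ∈ B s, ρ s a + ∑ t, (G.δ s a t).toReal * z t ≤ z s := by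
    intro s hs a ha
    rw [hzq s hs]
    refine (ENNReal.ofReal_le_iff_le_toReal hs).1 ?_
    rw [← backup_ofReal hz0]
    refine le_trans (le_of_eq ?_) (hqB s a ha)
    rw [backup, backup]
    congr 2
    refine sum_pmf_mul_congr _ fun t ht => ?_
    have htU := hUclosed s hs a ha t ht
    rw [hzq t htU, ENNReal.ofReal_toReal htU]
  -- `R 0 1` holds for the inequality, and then `α = 0` is allowed wherever `X` vanishes
  let D : Set S := {s | X s = 0 ∧ (R 0 1 ∨ B' s = G.enabled s)}
  obtain ⟨rank, hrank⟩ := exists_ranking (δ := G.δ) (r := r) (B := B') (D := D) <| by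
    intro N hND hN
    have hX0 : ∀ s ∈ N, X s = 0 := fun s hs => gameValue_eq_zero_of_trap hN hs
    by_contra hne
    have hnot : ∀ s ∈ N, ¬ R 0 1 ∧ B' s ≠ G.enabled s := fun s hs =>
      not_or.1 fun h => hND s hs ⟨hX0 s hs, h⟩
    have hNU : ∀ s ∈ N, s ∉ U := fun s hs hsU => (hnot s hs).2 (hB'U s hsU)
    -- in a state of `N` with minimal penalty, the local penalty would have to vanish
    obtain ⟨s, hs, hmin⟩ :=
      N.exists_min_image z N.toFinite (Set.nonempty_iff_ne_empty.2 hne)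
    obtain ⟨a, ha, -, hcl⟩ := hN s hs
    rw [hB'B s (hNU s hs)] at ha
    have hle : ρ s a + ∑ t, (G.δ s a t).toReal * z t ≤ z s := hzB s (hNU s hs) a ha
    have hge : z s ≤ ∑ t, (G.δ s a t).toReal * z t :=
      (sum_toReal_mul_const (G.δ s a) (z s)).symm.trans_le
        (sum_toReal_mul_mono _ fun t ht => hmin t (hcl t ht))
    have hBne : B s ≠ G.enabled s := hB'B s (hNU s hs) ▸ (hnot s hs).2
    have hctrl : s ∈ G.controller := by
      by_contra h
      exact hBne (hB.environment s h)
    obtain ⟨a', ha', ha'B⟩ : ∃ a' ∈ G.enabled s, a' ∉ B s := by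
      by_contra! h
      exact hBne ((hB.subset s).antisymm h)
    have hψ : ψ ⟨s, hctrl⟩ a' ≠ 0 := fun h0 => by
      have hsingle : G.enabled s = {a'} :=
        hR.resolve_left (hnot s hs).1 ⟨s, hctrl⟩ a' ha' h0
      have hmem := hB.subset s ha
      rw [hsingle, Finset.mem_singleton] at hmem
      exact ha'B (hmem ▸ ha)
    have hρpos : ψ ⟨s, hctrl⟩ a' ≤ ρ s a := by
      rw [hρ, penaltyReward_detMulti_controller hB ψ ⟨s, hctrl⟩ a]
      exact Finset.single_le_sum (f := fun a' => ψ ⟨s, hctrl⟩ a') (fun _ _ => zero_le)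
        (Finset.mem_sdiff.2 ⟨ha', ha'B⟩)
    have hpos : (0 : ℝ) < ρ s a := NNReal.coe_pos.2 ((pos_iff_ne_zero.2 hψ).trans_le hρpos)
    linarith
  have key := exists_feasible_of_ranking (b := b) (ψ := ψ) (c := c) hB' hRrefl (D := D)
    (rank := rank) (x := fun s => (X s).toReal) (z := z)
    (fun s => ⟨ENNReal.toReal_nonneg, ENNReal.toReal_le_of_le_ofReal zero_le_one
      (by simpa using (hX1 s).le)⟩) hz0
    ((ENNReal.ofReal_le_iff_le_toReal (hXfin _)).1 hXinit) ?_
    (fun s hs => by simp [hs.1]) ?_ hrank ?_ ?_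
  · obtain ⟨v, hv, hvz⟩ := key
    exact ⟨v, hv, hvz.trans (hzq _ hfin)⟩
  · intro s a ha
    have h := gameValue_le_backup (δ := G.δ) (ρ := r) (l := 1) (Set.notMem_empty s) ha
    rw [← hX, backup_toReal hXfin] at h
    rw [add_comm]
    exact ENNReal.toReal_le_of_le_ofReal (add_nonneg (NNReal.coe_nonneg _)
      (Finset.sum_nonneg fun t _ => mul_nonneg ENNReal.toReal_nonneg ENNReal.toReal_nonneg)) h
  · intro s hs a ha
    split_ifs with haB
    · exact hRrefl 1
    · exact hs.2.resolve_right fun h => haB (h ▸ ha)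
  · intro s a ha
    by_cases hs : (s : S) ∈ U
    · rw [hB'U s hs, if_pos ha, sdiff_self, hzU s hs]
      simpa using havgc s a
    · rw [hB'B s hs]
      obtain ⟨a₀, ha₀⟩ := hB.nonempty s
      have hρs : ∀ a, (ρ s a : ℝ) = ∑ a' ∈ G.enabled s \ B s, (ψ s a' : ℝ) := fun a => by
        rw [hρ, penaltyReward_detMulti_controller hB ψ s a, NNReal.coe_sum]
      rw [← hρs a]
      split_ifs with haB
      · linarith [hzB s hs a haB]
      · have h1 := hzB s hs a₀ ha₀
        rw [hρs a₀, ← hρs a] at h1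
        have h2 : 0 ≤ ∑ t, (G.δ s a₀ t).toReal * z t := Finset.sum_nonneg fun t _ =>
          mul_nonneg ENNReal.toReal_nonneg (hz0 t)
        linarith [havgc s a]
  · intro s hs a ha
    by_cases hsU : s ∈ U
    · rw [hzU s hsU]
      exact havgc s a
    · have := hzB s hsU a (hB.environment s hs ▸ ha)
      linarith [NNReal.coe_nonneg (ρ s a)]

end StochasticGame
end PermissiveSynthesis

theorem mainTheorem7 {S A : Type*} [Fintype S] [Fintype A]
    (G : PermissiveSynthesis.StochasticGame S A)
    (r : S → A → ℝ≥0) (b : ℝ) (ψ : G.controller → A → ℝ≥0) (c : ℝ≥0)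
    -- rewards are rescaled so that the maximal expected total reward is below 1 from every state
    (hr : ∀ s, G.maxReward r s < 1)
    -- `c` is no lower than any finite penalty of a deterministic multi-strategy
    (hc : ∀ θ : G.MultiStrategy, θ.IsDeterministic → ∀ s,
      θ.dynPenalty ψ s ≠ ⊤ → θ.dynPenalty ψ s ≤ c)
    -- there is a sound (possibly randomised) multi-strategy
    (hsound : ∃ θ : G.MultiStrategy, θ.Sound r b) :
    (∃ θ : G.MultiStrategy, θ.OptimallyPermissive r b ψ) ∧
    G.EncodingCorrect r b ψ c (· ≤ ·) ∧
    ((∀ s : G.controller, ∀ a ∈ G.enabled s, ψ s a = 0 → G.enabled s = {a}) →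
      G.EncodingCorrect r b ψ c (· = ·)) := by
  have hopt := PermissiveSynthesis.StochasticGame.exists_optimallyPermissive ψ hsound
  refine ⟨hopt, ?_, fun hψ => ?_⟩
  · refine PermissiveSynthesis.StochasticGame.encodingCorrect_of_translations hopt
      (fun v hv => hv.exists_sound hr fun _ _ h => h) fun θ hdet hs hfin => ?_
    obtain ⟨B, hB, rfl⟩ := hdet.exists_eq_detMulti
    exact PermissiveSynthesis.StochasticGame.exists_feasible_of_sound hB hr (hc _ hdet) hs hfin
      le_refl (Or.inl zero_le_one)
  · refine PermissiveSynthesis.StochasticGame.encodingCorrect_of_translations hopt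
      (fun v hv => hv.exists_sound hr fun _ _ h => h.le) fun θ hdet hs hfin => ?_
    obtain ⟨B, hB, rfl⟩ := hdet.exists_eq_detMulti
    exact PermissiveSynthesis.StochasticGame.exists_feasible_of_sound hB hr (hc _ hdet) hs hfin
      (fun _ => rfl) (Or.inr hψ)
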